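/- Call a function $S:[0,\infty)\to[0,\infty)$ \emph{subexponentially admissible} if it is convex and strictly increasing, three times continuously differentiable on $(0,\infty)$, and satisfies: (i) there is $T_0>0$ such that $t\mapsto \frac{d}{dt}S^2(t)$ is log-concave on $[T_0,\infty)$; (ii) $\int_{\mathbb R}\frac{|\log\max\{S^2(|t|),1\}|}{1+t^2}\,dt<\infty$. For $f\in L^1(\mathbb R)\cap L^2(\mathbb R)$ put $\hat f(\xi)=\int_{\mathbb R}f(x)e^{-2\pi i x\xi}\,dx$, and let \[ \mathcal H=\Bigl\{f\in L^2(\mathbb R):\int_{\mathbb R}(1+x^2)|f(x)|^2\,dx+\int_{\mathbb R}(1+\xi^2)|\hat f(\xi)|^2\,d\xi<\infty\Bigr\}, \] where $f\in\mathcal H$ (which is automatically integrable) is identified with its continuous representative. A pair $(\Lambda,M)$ of subsets of $\mathbb R$ is a \emph{Fourier uniqueness pair} for $\mathcal H$ if the only $f\in\mathcal H$ with $f|_\Lambda=0$ and $\hat f|_M=0$ is $f\equiv 0$. \textbf{Theorem.} Let $S$ be an injective real function with inverse $S^{-1}$ (defined on the range of $S$), such that either $S$ has domain $[0,\infty)$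 and is subexponentially admissible, or $S^{-1}$ has domain $[0,\infty)$ and is subexponentially admissible. Then there exist $d,\tilde d\in\mathbb R$, depending only on $S$, with $[\tilde d,\infty)$ contained in the domain of $S$ and $[d,\infty)$ contained in the domain of $S^{-1}$, such that the following holds. Let $(\lambda_j)_{j\in\mathbb Z}$ and $(\mu_j)_{j\in\mathbb Z}$ be strictly increasing sequences of real numbers with $\lim_{j\to\pm\infty}\lambda_j=\pm\infty$ and $\lim_{j\to\pm\infty}\mu_j=\pm\infty$. If \[ \sup_{j\in\mathbb Z}S(|\lambda_j|+\tilde d)(\lambda_{j+1}-\lambda_j)\le\tfrac12 \quad\text{and}\quad \sup_{j\in\mathbb Z}S^{-1}(|\mu_j|+d)(\mu_{j+1}-\mu_j)\le\tfrac12, \] then $(\{\lambda_j\}_{j\in\mathbb Z},\{\mu_j\}_{j\in\mathbb Z})$ is a Fourier uniqueness pair for $\mathcal H$. -/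

import Mathlib

open Set Filter MeasureTheory
open scoped FourierTransform

/-- A function `S : [0,∞) → [0,∞)` (only its values on `[0,∞)` are used) is
*subexponentially admissible*: it is convex and increasing on `[0,∞)`, three times continuously
differentiable on `(0,∞)`, the derivative of `S²` is log-concave on some `[T₀,∞)` with `T₀ > 0`
(this derivative is positive on `(0,∞)` by the other conditions), and the logarithmic integral
of `max {S(|t|)², 1}` against `dt / (1 + t²)` converges. -/
structure SubexpAdmissible (S : ℝ → ℝ) : Prop where
  nonneg : ∀ t, 0 ≤ t → 0 ≤ S t
  convexOn : ConvexOn ℝ (Ici 0) S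
  strictMonoOn : StrictMonoOn S (Ici 0)
  contDiffOn : ContDiffOn ℝ 3 S (Ioi 0)
  logConcave : ∃ T₀ : ℝ, 0 < T₀ ∧
    ConcaveOn ℝ (Ici T₀) (fun t : ℝ => Real.log (deriv (fun s : ℝ => S s ^ 2) t))
  integrable_log :
    Integrable (fun t : ℝ => |Real.log (max (S |t| ^ 2) 1)| / (1 + t ^ 2)) volume

/-- The Fourier symmetric Sobolev space: square-integrable functions for which both `f` and its
Fourier transform are square-integrable against the weight `1 + x²`. Each class in the space has
exactly one continuous representative, and it is this representative that is taken here, so that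
point values make sense. Its members are integrable (see `FourierSobolev.integrable`), so `𝓕 f` is
the Fourier integral `∫ f(x) exp(-2πixξ) dx`. -/
def FourierSobolev : Set (ℝ → ℂ) :=
  {f | Continuous f ∧ MemLp f 2 volume ∧
    Integrable (fun x : ℝ => (1 + x ^ 2) * ‖f x‖ ^ 2) volume ∧
    Integrable (fun ξ : ℝ => (1 + ξ ^ 2) * ‖𝓕 f ξ‖ ^ 2) volume}

theorem FourierSobolev.integrable {f : ℝ → ℂ} (hf : f ∈ FourierSobolev) :
    Integrable f volume := by
  obtain ⟨hc, -, h1, -⟩ := hf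
  refine Integrable.mono' (h1.add integrable_inv_one_add_sq) hc.aestronglyMeasurable
    (Eventually.of_forall fun x => ?_)
  have hx : (0 : ℝ) < 1 + x ^ 2 := by positivity
  have key : (1 + x ^ 2) * ‖f x‖ ^ 2 + (1 + x ^ 2)⁻¹ - ‖f x‖
      = (1 + x ^ 2) * (‖f x‖ - (1 + x ^ 2)⁻¹) ^ 2 + ‖f x‖ := by
    field_simp
    ring
  have h2 : 0 ≤ (1 + x ^ 2) * (‖f x‖ - (1 + x ^ 2)⁻¹) ^ 2 + ‖f x‖ := by positivity
  simp only [Pi.add_apply]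
  linarith

/-- `(Λ, M)` is a Fourier uniqueness pair for `X`: the only function in `X` that vanishes on `Λ`
and whose Fourier transform vanishes on `M` is the zero function. -/
def IsFourierUniquenessPair (Λ M : Set ℝ) (X : Set (ℝ → ℂ)) : Prop :=
  ∀ f ∈ X, (∀ x ∈ Λ, f x = 0) → (∀ ξ ∈ M, 𝓕 f ξ = 0) → ∀ x, f x = 0

/-- A two-sided strictly increasing real sequence tending to `±∞` at `±∞`. -/
structure IsOrderedSequence (a : ℤ → ℝ) : Prop where
  strictMono : StrictMono a
  tendsto_atTop : Tendsto a atTop atTop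
  tendsto_atBot : Tendsto a atBot atBot

/-!
Let `S` be admissible with inverse `R`, and let `f` vanish on `Λ` and `g = 𝓕 f` on `M`. (If the
inverse of `S` is the admissible one, `f` is replaced by the conjugate of `𝓕 f`.) Wirtinger's
inequality on the gaps of `Λ` and of `M` turns the density conditions into
`∫ S(|x| + c)² |f|² ≤ ∫ ξ² |g|²` and `∫ R(|ξ| + c)² |g|² ≤ ∫ x² |f|²`. Put differently, `f` lives
in the part `|ξ| > S(|x| + c)` of phase space and, at the same time, in the part
`|x| > R(|ξ| + c)`. The two parts are disjoint, and the proof makes this contradiction rigorous.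

If `P` is a translate of `S` with `P(0) = 0`, then `u ↦ P(√u)²` is convex, so for each frequency `s`
the function `P(|x|)²` lies above a tangent parabola `s² + h(s) (x² - ρ(s)²)`, where
`P(ρ(s)) = |s|`; see `SubexpAdmissible.parabola_le`. (For `|s| < 1` the parabola belonging to
`s = 1` is used.) To use the parabola that fits the frequency, `f` is decomposed by its short-time
Fourier transform with a window `p` supported in `[-1, 1]`. Three facts make this decomposition
lossless up to shifts of the argument of `S` and `R`:

* summing `P(|x|)²` over all pieces amounts to averaging it over translations by at most `1`, so
  that the total is at most `∫ S(|x| + c)² |f|² ≤ ∫ ξ² |g|²` (`lintegral_shortTimeFourier`);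
* the piece at frequency `s` has Fourier transform `𝓕 p (ξ + s) g(ξ)`, which still vanishes on `M`,
  so Wirtinger's inequality (`lintegral_sq_mul_fourier_le`) bounds its second moment from below by
  `∫ R(|ξ| + c)² |𝓕 p (ξ + s)|² |g|²`;
* the average of `s²` against `|𝓕 p (ξ + s)|²` is `ξ² + m` with `m > 0`
  (`lintegral_sq_mul_comp_add`).

Together they give `∫ (ξ² + m) |g|² ≤ ∫ ξ² |g|²`, hence `f = 0` (`eq_zero_of_kernel_le`), as soon as
`∫ h(s) (R(|ξ| + c)² - ρ(s)²) |𝓕 p (ξ + s)|² ds` is nonnegative for every `ξ`. The integrand is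
positive unless `|s|` exceeds `|ξ|` by a large amount, where `𝓕 p` is tiny. It remains to know that
`h` grows at most polynomially on each scale (`IsProfile.exists_shift`), and this follows from the
log-concavity of the derivative of `S²` (`SubexpAdmissible.exists_growth`).
-/

/-! ### Plancherel's identity on `L¹ ∩ L²` -/

/-- The abstract `L²` Fourier transform and the Fourier integral agree as tempered
distributions. -/
theorem integral_smul_fourier_toLp {u : ℝ → ℂ} (h1 : Integrable u) (h2 : MemLp u 2)
    (Φ : SchwartzMap ℝ ℂ) :
    ∫ x, Φ x • (𝓕 (h2.toLp u) : Lp ℂ 2 (volume : Measure ℝ)) x = ∫ x, Φ x • 𝓕 u x := by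
  have e1 : ∫ x, Φ x • (𝓕 (h2.toLp u) : Lp ℂ 2 (volume : Measure ℝ)) x
      = ∫ x, (𝓕 Φ) x • u x := by
    have := congrArg (fun T => T Φ) (Lp.fourier_toTemperedDistribution_eq (h2.toLp u))
    simp only [TemperedDistribution.fourier_apply] at this
    rw [Lp.toTemperedDistribution_apply, Lp.toTemperedDistribution_apply] at this
    rw [← this]
    refine integral_congr_ae ?_
    filter_upwards [h2.coeFn_toLp] with x hx
    rw [hx]
  have e2 := VectorFourier.integral_fourierIntegral_smul_eq_flip (L := innerₗ ℝ)
      (μ := volume) (ν := volume) Real.continuous_fourierChar continuous_inner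
      (Φ.integrable) h1
  rw [flip_innerₗ] at e2
  rw [e1, SchwartzMap.fourier_coe]
  exact e2

/-- On `L²`, the abstract Fourier transform of an integrable function is its Fourier integral. -/
theorem fourier_toLp_ae_eq {u : ℝ → ℂ} (h1 : Integrable u) (h2 : MemLp u 2) :
    (𝓕 (h2.toLp u) : Lp ℂ 2 (volume : Measure ℝ)) =ᵐ[volume] 𝓕 u := by
  have hcont : Continuous (𝓕 u) :=
    VectorFourier.fourierIntegral_continuous Real.continuous_fourierChar
      (by exact continuous_inner) h1
  have hI := integral_smul_fourier_toLp h1 h2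
  generalize (𝓕 (h2.toLp u) : Lp ℂ 2 (volume : Measure ℝ)) = U at hI ⊢
  have hUloc : LocallyIntegrable (fun x => U x) volume :=
    (Lp.memLp U).locallyIntegrable (by norm_num)
  have hloc : LocallyIntegrable (fun x => U x - 𝓕 u x) volume :=
    hUloc.sub hcont.locallyIntegrable
  have key := ae_eq_zero_of_integral_contDiff_smul_eq_zero hloc (fun φ hφ hφc => by
    have hφ' : HasCompactSupport (fun x => (φ x : ℂ)) :=
      hφc.comp_left (g := fun r : ℝ => (r : ℂ)) Complex.ofReal_zero
    have hφd : ContDiff ℝ (⊤ : ℕ∞) (fun x => (φ x : ℂ)) := Complex.ofRealCLM.contDiff.comp hφ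
    have i1 : Integrable (fun x => φ x • U x) volume :=
      hUloc.integrable_smul_left_of_hasCompactSupport hφ.continuous hφc
    have i2 : Integrable (fun x => φ x • 𝓕 u x) volume :=
      hcont.locallyIntegrable.integrable_smul_left_of_hasCompactSupport hφ.continuous hφc
    simp only [smul_sub]
    rw [integral_sub i1 i2, sub_eq_zero]
    exact hI (hφ'.toSchwartzMap hφd))
  filter_upwards [key] with x hx
  exact sub_eq_zero.mp hx

/-- Plancherel's identity for the Fourier integral on `L¹ ∩ L²`. -/
theorem lintegral_enorm_sq_fourier {u : ℝ → ℂ} (h1 : Integrable u) (h2 : MemLp u 2) :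
    ∫⁻ ξ, ‖𝓕 u ξ‖ₑ ^ 2 = ∫⁻ x, ‖u x‖ₑ ^ 2 := by
  have h : eLpNorm (𝓕 u) 2 volume = eLpNorm u 2 volume := by
    rw [← eLpNorm_congr_ae (fourier_toLp_ae_eq h1 h2), ← eLpNorm_congr_ae h2.coeFn_toLp,
      ← Lp.enorm_def, ← Lp.enorm_def, ← ofReal_norm, ← ofReal_norm, Lp.norm_fourier_eq]
  have := congrArg (fun t => t ^ (2 : ℝ)) h
  simp only [eLpNorm_eq_lintegral_rpow_enorm_toReal two_ne_zero ENNReal.ofNat_ne_top,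
    ← ENNReal.rpow_mul, ENNReal.toReal_ofNat] at this
  norm_num at this
  exact this

/-! ### Wirtinger's inequality between the zeros of a Fourier transform -/

/-- Wirtinger's inequality with a constant below the optimal one, for functions which need not
vanish at the end points. It is the positivity of `∫ ‖F' + τ F‖²`, where
`τ x = κ tan (κ (x - (a + b) / 2))` solves the Riccati equation `τ' = κ² + τ²`. -/
theorem wirtinger_of_hasDerivAt {F F' : ℝ → ℂ} (hF : ∀ x, HasDerivAt F (F' x) x)
    (hF' : Continuous F') {a b κ : ℝ} (hab : a ≤ b) (hκ : 0 ≤ κ)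
    (hκ' : κ * (b - a) < Real.pi) :
    κ ^ 2 * ∫ x in a..b, ‖F x‖ ^ 2 ≤
      (∫ x in a..b, ‖F' x‖ ^ 2) +
        κ * Real.tan (κ * ((b - a) / 2)) * (‖F a‖ ^ 2 + ‖F b‖ ^ 2) := by
  set m := (a + b) / 2 with hm
  have hFc : Continuous F := continuous_iff_continuousAt.2 fun x => (hF x).continuousAt
  let τ : ℝ → ℝ := fun x => κ * Real.tan (κ * (x - m))
  have hcos : ∀ x ∈ Icc a b, Real.cos (κ * (x - m)) ≠ 0 := by
    intro x hx
    have h1 : -(b - a) / 2 ≤ x - m := by rw [hm]; linarith [hx.1]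
    have h2 : x - m ≤ (b - a) / 2 := by rw [hm]; linarith [hx.2]
    refine (Real.cos_pos_of_mem_Ioo ⟨?_, ?_⟩).ne'
    · nlinarith [mul_le_mul_of_nonneg_left h1 hκ]
    · nlinarith [mul_le_mul_of_nonneg_left h2 hκ]
  have hτ : ∀ x ∈ Icc a b, HasDerivAt τ (κ ^ 2 + τ x ^ 2) x := by
    intro x hx
    have hlin : HasDerivAt (fun x : ℝ => κ * (x - m)) κ x := by
      simpa using ((hasDerivAt_id x).sub_const m).const_mul κ
    have h1 := ((Real.hasDerivAt_tan (hcos x hx)).comp x hlin).const_mul κ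
    refine h1.congr_deriv ?_
    have h2 := Real.inv_one_add_tan_sq (hcos x hx)
    have h3 : 1 / Real.cos (κ * (x - m)) ^ 2 = 1 + Real.tan (κ * (x - m)) ^ 2 := by
      rw [← h2]; simp
    rw [h3]
    ring
  have hτc : ContinuousOn τ (Icc a b) := fun x hx => (hτ x hx).continuousAt.continuousWithinAt
  have hder : ∀ x ∈ Icc a b, HasDerivAt (fun x => τ x * ‖F x‖ ^ 2)
      (‖F' x + τ x • F x‖ ^ 2 - (‖F' x‖ ^ 2 - κ ^ 2 * ‖F x‖ ^ 2)) x := by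
    intro x hx
    refine ((hτ x hx).mul (hF x).norm_sq).congr_deriv ?_
    have e : ‖τ x • F x‖ ^ 2 = τ x ^ 2 * ‖F x‖ ^ 2 := by
      rw [norm_smul, mul_pow, Real.norm_eq_abs, sq_abs]
    rw [norm_add_sq_real, inner_smul_right, real_inner_comm, e]
    ring
  have hc1 : ContinuousOn (fun x => ‖F' x + τ x • F x‖ ^ 2) (Icc a b) :=
    ((hF'.continuousOn.add (hτc.smul hFc.continuousOn)).norm).pow 2
  have hc2 : Continuous (fun x => ‖F' x‖ ^ 2) := by fun_prop
  have hc3 : Continuous (fun x => ‖F x‖ ^ 2) := by fun_prop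
  have hi1 : IntervalIntegrable (fun x => ‖F' x + τ x • F x‖ ^ 2) volume a b :=
    hc1.intervalIntegrable_of_Icc hab
  have hi23 : IntervalIntegrable (fun x => ‖F' x‖ ^ 2 - κ ^ 2 * ‖F x‖ ^ 2) volume a b :=
    (hc2.intervalIntegrable a b).sub ((hc3.intervalIntegrable a b).const_mul _)
  have hftc := intervalIntegral.integral_eq_sub_of_hasDerivAt
    (fun x hx => hder x (by rwa [uIcc_of_le hab] at hx)) (hi1.sub hi23)
  rw [intervalIntegral.integral_sub hi1 hi23,
    intervalIntegral.integral_sub (hc2.intervalIntegrable a b)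
      ((hc3.intervalIntegrable a b).const_mul _), intervalIntegral.integral_const_mul] at hftc
  have hpos : 0 ≤ ∫ x in a..b, ‖F' x + τ x • F x‖ ^ 2 :=
    intervalIntegral.integral_nonneg hab fun x _ => by positivity
  have hb : τ b = κ * Real.tan (κ * ((b - a) / 2)) := by
    simp only [τ]; congr 3; rw [hm]; ring
  have ha : τ a = -(κ * Real.tan (κ * ((b - a) / 2))) := by
    simp only [τ]
    rw [← mul_neg, ← Real.tan_neg]; congr 2; rw [hm]; ring
  rw [ha, hb] at hftc
  linarith

/-- The intervals between consecutive points of an ordered sequence cover the line. -/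
theorem IsOrderedSequence.iUnion_Ioc {a : ℤ → ℝ} (ha : IsOrderedSequence a) :
    ⋃ j, Ioc (a j) (a (j + 1)) = univ := by
  refine eq_univ_of_forall fun x => ?_
  obtain ⟨j₀, hj₀⟩ := (ha.tendsto_atBot.eventually_lt_atBot x).exists
  obtain ⟨j₁, hj₁⟩ := (ha.tendsto_atTop.eventually_ge_atTop x).exists
  obtain ⟨j, hj, hmax⟩ := Int.exists_greatest_of_bdd (P := fun j => a j < x)
    ⟨j₁, fun z hz => (ha.strictMono.lt_iff_lt.1 (hz.trans_le hj₁)).le⟩ ⟨j₀, hj₀⟩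
  refine mem_iUnion.2 ⟨j, hj, ?_⟩
  by_contra! h
  have := hmax _ h
  omega

/-- The sum over finitely many intervals of Wirtinger's inequality for `𝓕 G`, whose derivative is
the Fourier transform of `-2πi x G(x)`. -/
theorem sum_wirtinger_fourier {G : ℝ → ℂ} (hG : Integrable G)
    (hG1 : Integrable (fun x : ℝ => x • G x)) (hG2 : MemLp (fun x : ℝ => x • G x) 2)
    {a : ℤ → ℝ} (ha : StrictMono a) (s : Finset ℤ) {κ : ℤ → ℝ} (hκ : ∀ j, 0 ≤ κ j)
    (hκ' : ∀ j, κ j * (a (j + 1) - a j) < Real.pi) :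
    ∑ j ∈ s, κ j ^ 2 * ∫ x in a j..a (j + 1), ‖𝓕 G x‖ ^ 2 ≤
      (2 * Real.pi) ^ 2 * (∫ x, x ^ 2 * ‖G x‖ ^ 2) +
        ∑ j ∈ s, κ j * Real.tan (κ j * ((a (j + 1) - a j) / 2)) *
          (‖𝓕 G (a j)‖ ^ 2 + ‖𝓕 G (a (j + 1))‖ ^ 2) := by
  set H : ℝ → ℂ := fun x => (-2 * Real.pi * Complex.I * x) • G x with hH
  have hHeq : H = fun x => (-2 * Real.pi * Complex.I : ℂ) * (x • G x) := by
    ext x; simp [H, mul_assoc]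
  have hH1 : Integrable H := by rw [hHeq]; exact hG1.const_mul _
  have hH2 : MemLp H 2 := by rw [hHeq]; exact hG2.const_mul _
  have hder : ∀ x, HasDerivAt (𝓕 G) (𝓕 H x) x := fun x => Real.hasDerivAt_fourier hG hG1 x
  have hcont : Continuous (𝓕 H) :=
    VectorFourier.fourierIntegral_continuous Real.continuous_fourierChar
      (by exact continuous_inner) hH1
  have hpl := lintegral_enorm_sq_fourier hH1 hH2
  have hint : Integrable (fun x => ‖𝓕 H x‖ ^ 2) := by
    refine ⟨by fun_prop, ?_⟩
    have h2 : ∫⁻ x, ‖H x‖ₑ ^ 2 < ⊤ := by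
      have := hH2.integrable_norm_pow (two_ne_zero)
      have h3 := this.2
      simpa [HasFiniteIntegral, enorm_pow] using h3
    simpa [HasFiniteIntegral, enorm_pow, hpl] using h2
  have hval : ∫ x, ‖𝓕 H x‖ ^ 2 = (2 * Real.pi) ^ 2 * ∫ x, x ^ 2 * ‖G x‖ ^ 2 := by
    have e : ∫ x, ‖𝓕 H x‖ ^ 2 = ∫ x, ‖H x‖ ^ 2 := by
      have hm : AEStronglyMeasurable (fun x => ‖H x‖ ^ 2) := hH1.aestronglyMeasurable.norm.pow 2
      rw [integral_eq_lintegral_of_nonneg_ae (Eventually.of_forall fun x => by positivity)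
        (by fun_prop), integral_eq_lintegral_of_nonneg_ae
        (Eventually.of_forall fun x => by positivity) hm]
      simp only [ENNReal.ofReal_pow (norm_nonneg _), ofReal_norm, hpl]
    rw [e, ← integral_const_mul]
    refine integral_congr_ae (Eventually.of_forall fun x => ?_)
    simp only [H, norm_smul, norm_mul, norm_neg, Complex.norm_real, Complex.norm_I,
      Complex.norm_ofNat, Real.norm_eq_abs, mul_pow, sq_abs]
    ring
  have hle : ∑ j ∈ s, ∫ x in a j..a (j + 1), ‖𝓕 H x‖ ^ 2 ≤ ∫ x, ‖𝓕 H x‖ ^ 2 := by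
    have hdisj : Pairwise (Function.onFun Disjoint fun j => Ioc (a j) (a (j + 1))) :=
      ha.monotone.pairwise_disjoint_on_Ioc_succ
    have e : ∑ j ∈ s, ∫ x in a j..a (j + 1), ‖𝓕 H x‖ ^ 2
        = ∫ x in ⋃ j ∈ s, Ioc (a j) (a (j + 1)), ‖𝓕 H x‖ ^ 2 := by
      rw [integral_biUnion_finset s (fun j _ => measurableSet_Ioc)
        (fun i _ j _ hij => hdisj hij) (fun j _ => hint.integrableOn)]
      exact Finset.sum_congr rfl fun j _ => intervalIntegral.integral_of_le
        (ha (lt_add_one j)).le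
    rw [e]
    exact setIntegral_le_integral hint (Eventually.of_forall fun x => by positivity)
  rw [← hval]
  refine le_trans (Finset.sum_le_sum fun j _ => wirtinger_of_hasDerivAt hder hcont
    (ha (lt_add_one j)).le (hκ j) (hκ' j)) ?_
  rw [Finset.sum_add_distrib]
  gcongr

/-- The previous inequality without boundary terms, when the Fourier transform vanishes at the end
points of the intervals. Only the moment on the right needs to be finite: cutting `G` off
perturbs the boundary values by a quantity that tends to zero. -/
theorem sum_wirtinger_fourier_of_zeros {G : ℝ → ℂ} (hG : Integrable G)
    (hG2 : Integrable (fun x : ℝ => x ^ 2 * ‖G x‖ ^ 2))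
    {a : ℤ → ℝ} (ha : StrictMono a) (hz : ∀ j, 𝓕 G (a j) = 0) (s : Finset ℤ) {κ : ℤ → ℝ}
    (hκ : ∀ j, 0 ≤ κ j) (hκ' : ∀ j, κ j * (a (j + 1) - a j) < Real.pi) :
    ∑ j ∈ s, κ j ^ 2 * ∫ x in a j..a (j + 1), ‖𝓕 G x‖ ^ 2 ≤
      (2 * Real.pi) ^ 2 * ∫ x, x ^ 2 * ‖G x‖ ^ 2 := by
  let Gn : ℕ → ℝ → ℂ := fun n => (Icc (-n : ℝ) n).indicator G
  have hGn : ∀ n, Integrable (Gn n) := fun n => hG.indicator measurableSet_Icc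
  have hnorm : ∀ n x, ‖Gn n x‖ ≤ ‖G x‖ := fun n x => norm_indicator_le_norm_self _ _
  have hGn1 : ∀ n, Integrable (fun x : ℝ => x • Gn n x) := fun n => by
    refine (hG.norm.const_mul (n : ℝ)).mono'
      (continuous_id.aestronglyMeasurable.smul (hGn n).aestronglyMeasurable)
      (Eventually.of_forall fun x => ?_)
    by_cases hx : x ∈ Icc (-n : ℝ) n
    · rw [norm_smul, Real.norm_eq_abs]
      exact mul_le_mul (abs_le.2 hx) (hnorm n x) (norm_nonneg _) (by positivity)
    · simp only [Gn, indicator_of_notMem hx, smul_zero, norm_zero]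
      positivity
  have hle2 : ∀ n x, x ^ 2 * ‖Gn n x‖ ^ 2 ≤ x ^ 2 * ‖G x‖ ^ 2 := fun n x => by
    gcongr; exact hnorm n x
  have hGn3 : ∀ n, Integrable (fun x : ℝ => x ^ 2 * ‖Gn n x‖ ^ 2) := fun n => by
    refine hG2.mono' ((continuous_pow 2).aestronglyMeasurable.mul
      ((hGn n).aestronglyMeasurable.norm.pow 2)) (Eventually.of_forall fun x => ?_)
    rw [Real.norm_of_nonneg (by positivity)]
    exact hle2 n x
  have hGn2 : ∀ n, MemLp (fun x : ℝ => x • Gn n x) 2 := fun n => by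
    refine (memLp_two_iff_integrable_sq_norm (hGn1 n).aestronglyMeasurable).2 ?_
    refine (hGn3 n).congr (Eventually.of_forall fun x => ?_)
    simp only [norm_smul, Real.norm_eq_abs, mul_pow, sq_abs]
  have hlim : ∀ x, Tendsto (fun n => 𝓕 (Gn n) x) atTop (nhds (𝓕 G x)) := fun x => by
    simp only [Real.fourier_real_eq]
    refine tendsto_integral_of_dominated_convergence (fun y => ‖G y‖) (fun n => ?_) hG.norm
      (fun n => Eventually.of_forall fun y => ?_) (Eventually.of_forall fun y => ?_)
    · exact ((Real.fourierIntegral_convergent_iff x).2 (hGn n)).aestronglyMeasurable.congr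
        (Eventually.of_forall fun y => by simp [mul_comm])
    · rw [Circle.norm_smul]; exact hnorm n y
    · refine tendsto_const_nhds.congr' ?_
      filter_upwards [eventually_ge_atTop ⌈|y|⌉₊] with n hn
      have : y ∈ Icc (-n : ℝ) n := abs_le.1 (Nat.ceil_le.1 hn)
      simp only [Gn, indicator_of_mem this]
  have hbound : ∀ n x, ‖𝓕 (Gn n) x‖ ≤ ∫ y, ‖G y‖ := fun n x =>
    (VectorFourier.norm_fourierIntegral_le_integral_norm _ _ _ _ _).trans
      (integral_mono (hGn n).norm hG.norm (hnorm n))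
  have hcont : ∀ n, Continuous (𝓕 (Gn n)) := fun n =>
    VectorFourier.fourierIntegral_continuous Real.continuous_fourierChar
      (by exact continuous_inner) (hGn n)
  have hL : Tendsto (fun n => ∑ j ∈ s, κ j ^ 2 * ∫ x in a j..a (j + 1), ‖𝓕 (Gn n) x‖ ^ 2) atTop
      (nhds (∑ j ∈ s, κ j ^ 2 * ∫ x in a j..a (j + 1), ‖𝓕 G x‖ ^ 2)) := by
    refine tendsto_finsetSum _ fun j _ => Tendsto.const_mul _ ?_
    refine intervalIntegral.tendsto_integral_filter_of_dominated_convergence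
      (fun _ => (∫ y, ‖G y‖) ^ 2) (Eventually.of_forall fun n =>
        ((hcont n).norm.pow 2).aestronglyMeasurable)
      (Eventually.of_forall fun n => Eventually.of_forall fun x _ => ?_)
      intervalIntegrable_const (Eventually.of_forall fun x _ => ((hlim x).norm.pow 2))
    rw [Real.norm_of_nonneg (by positivity)]
    gcongr
    exact hbound n x
  have hR : Tendsto (fun n => (2 * Real.pi) ^ 2 * (∫ x, x ^ 2 * ‖G x‖ ^ 2) +
        ∑ j ∈ s, κ j * Real.tan (κ j * ((a (j + 1) - a j) / 2)) *
          (‖𝓕 (Gn n) (a j)‖ ^ 2 + ‖𝓕 (Gn n) (a (j + 1))‖ ^ 2)) atTop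
      (nhds ((2 * Real.pi) ^ 2 * (∫ x, x ^ 2 * ‖G x‖ ^ 2) +
        ∑ j ∈ s, κ j * Real.tan (κ j * ((a (j + 1) - a j) / 2)) *
          (‖𝓕 G (a j)‖ ^ 2 + ‖𝓕 G (a (j + 1))‖ ^ 2))) :=
    (tendsto_finsetSum _ fun j _ => (((hlim _).norm.pow 2).add
      ((hlim _).norm.pow 2)).const_mul _).const_add _
  have := le_of_tendsto_of_tendsto' hL hR fun n =>
    (sum_wirtinger_fourier (hGn n) (hGn1 n) (hGn2 n) ha s hκ hκ').trans (by
      exact add_le_add_left (mul_le_mul_of_nonneg_left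
        (integral_mono (hGn3 n) hG2 (hle2 n)) (by positivity)) _)
  simpa [hz] using this

/-- If the Fourier transform of `G` vanishes on an ordered sequence whose gaps are at most
`1 / (2 B)`, then `B` times this Fourier transform is dominated by `ξ G(ξ)` in `L²`. -/
theorem lintegral_sq_mul_fourier_le {G : ℝ → ℂ} (hG : Integrable G) {a : ℤ → ℝ}
    (ha : IsOrderedSequence a) (hz : ∀ j, 𝓕 G (a j) = 0) {B : ℝ → ℝ} (hB0 : ∀ x, 0 ≤ B x)
    (hB : ∀ j, ∀ x ∈ Ioc (a j) (a (j + 1)), B x * (a (j + 1) - a j) ≤ 1 / 2) :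
    ∫⁻ x, ENNReal.ofReal (B x ^ 2) * ‖𝓕 G x‖ₑ ^ 2 ≤
      ∫⁻ x, ENNReal.ofReal (x ^ 2) * ‖G x‖ₑ ^ 2 := by
  by_cases htop : ∫⁻ x, ENNReal.ofReal (x ^ 2) * ‖G x‖ₑ ^ 2 = ⊤
  · rw [htop]; exact le_top
  have henorm : ∀ x : ℝ, ENNReal.ofReal (x ^ 2) * ‖G x‖ₑ ^ 2
      = ENNReal.ofReal (x ^ 2 * ‖G x‖ ^ 2) := fun x => by
    rw [ENNReal.ofReal_mul (by positivity), ENNReal.ofReal_pow (norm_nonneg _), ofReal_norm]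
  have hmeas : AEStronglyMeasurable (fun x : ℝ => x ^ 2 * ‖G x‖ ^ 2) :=
    (continuous_pow 2).aestronglyMeasurable.mul (hG.aestronglyMeasurable.norm.pow 2)
  have hG2 : Integrable (fun x : ℝ => x ^ 2 * ‖G x‖ ^ 2) := by
    refine ⟨hmeas, ?_⟩
    rw [hasFiniteIntegral_iff_ofReal (Eventually.of_forall fun x => by positivity)]
    simp only [henorm] at htop
    exact lt_top_iff_ne_top.2 htop
  have hcont : Continuous (𝓕 G) :=
    VectorFourier.fourierIntegral_continuous Real.continuous_fourierChar
      (by exact continuous_inner) hG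
  set C := ∫ x, x ^ 2 * ‖G x‖ ^ 2 with hC
  have hCeq : ∫⁻ x, ENNReal.ofReal (x ^ 2) * ‖G x‖ₑ ^ 2 = ENNReal.ofReal C := by
    simp only [henorm]
    exact (ofReal_integral_eq_lintegral_ofReal hG2
      (Eventually.of_forall fun x => by positivity)).symm
  have hgap : ∀ j, 0 < a (j + 1) - a j := fun j => sub_pos.2 (ha.strictMono (lt_add_one j))
  -- the inequality up to a factor `θ < 1`
  have hθ : ∀ θ ∈ Ioo (0 : ℝ) 1, ENNReal.ofReal (θ ^ 2) *
      ∫⁻ x, ENNReal.ofReal (B x ^ 2) * ‖𝓕 G x‖ₑ ^ 2 ≤ ENNReal.ofReal C := by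
    intro θ hθ
    let κ : ℤ → ℝ := fun j => θ * Real.pi / (a (j + 1) - a j)
    have hκ : ∀ j, 0 ≤ κ j := fun j =>
      div_nonneg (mul_nonneg hθ.1.le Real.pi_pos.le) (hgap j).le
    have hκ' : ∀ j, κ j * (a (j + 1) - a j) < Real.pi := fun j => by
      simp only [κ]
      rw [div_mul_cancel₀ _ (hgap j).ne']
      nlinarith [Real.pi_pos, hθ.2]
    have hBκ : ∀ j, ∀ x ∈ Ioc (a j) (a (j + 1)), θ * B x ≤ κ j / (2 * Real.pi) := by
      intro j x hx
      have h1 : B x ≤ 1 / (2 * (a (j + 1) - a j)) := by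
        rw [le_div_iff₀ (by linarith [hgap j])]
        linarith [hB j x hx]
      have h2 : κ j / (2 * Real.pi) = θ * (1 / (2 * (a (j + 1) - a j))) := by
        simp only [κ]
        have := (hgap j).ne'
        have := Real.pi_pos.ne'
        field_simp
      rw [h2]
      exact mul_le_mul_of_nonneg_left h1 hθ.1.le
    have hterm : ∀ j, ENNReal.ofReal (θ ^ 2) * ∫⁻ x in Ioc (a j) (a (j + 1)),
        ENNReal.ofReal (B x ^ 2) * ‖𝓕 G x‖ₑ ^ 2 ≤ ENNReal.ofReal
          ((κ j ^ 2 * ∫ x in a j..a (j + 1), ‖𝓕 G x‖ ^ 2) / (2 * Real.pi) ^ 2) := by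
      intro j
      rw [← lintegral_const_mul' _ _ ENNReal.ofReal_ne_top,
        show (κ j ^ 2 * ∫ x in a j..a (j + 1), ‖𝓕 G x‖ ^ 2) / (2 * Real.pi) ^ 2
          = ∫ x in a j..a (j + 1), (κ j / (2 * Real.pi)) ^ 2 * ‖𝓕 G x‖ ^ 2 by
          rw [intervalIntegral.integral_const_mul]; ring,
        intervalIntegral.integral_of_le (hgap j |> sub_pos.1).le,
        ofReal_integral_eq_lintegral_ofReal]
      · refine setLIntegral_mono' measurableSet_Ioc fun x hx => ?_
        rw [← mul_assoc, ← ENNReal.ofReal_mul (by positivity),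
          ENNReal.ofReal_mul (q := ‖𝓕 G x‖ ^ 2) (by positivity),
          ENNReal.ofReal_pow (norm_nonneg (𝓕 G x)), ofReal_norm, ← mul_pow]
        gcongr
        · exact mul_nonneg hθ.1.le (hB0 x)
        · exact hBκ j x hx
      · exact ((hcont.norm.pow 2).const_mul _ |>.integrableOn_Icc).mono_set Ioc_subset_Icc_self
      · exact Eventually.of_forall fun x => by positivity
    have hdisj : Pairwise (Function.onFun Disjoint fun j => Ioc (a j) (a (j + 1))) :=
      ha.strictMono.monotone.pairwise_disjoint_on_Ioc_succ
    rw [← setLIntegral_univ, ← ha.iUnion_Ioc,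
      lintegral_iUnion (fun j => measurableSet_Ioc) hdisj, ← ENNReal.tsum_mul_left]
    rw [ENNReal.tsum_eq_iSup_sum]
    refine iSup_le fun s => (Finset.sum_le_sum fun j _ => hterm j).trans ?_
    rw [← ENNReal.ofReal_sum_of_nonneg, ← Finset.sum_div]
    · refine ENNReal.ofReal_le_ofReal ?_
      rw [div_le_iff₀ (by positivity), mul_comm]
      exact sum_wirtinger_fourier_of_zeros hG hG2 ha.strictMono hz s hκ hκ'
    · intro j _
      exact div_nonneg (mul_nonneg (sq_nonneg _) (intervalIntegral.integral_nonneg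
        (hgap j |> sub_pos.1).le fun x _ => by positivity)) (by positivity)
  rw [hCeq]
  have hlim : Tendsto (fun θ : ℝ => ENNReal.ofReal (θ ^ 2) *
      ∫⁻ x, ENNReal.ofReal (B x ^ 2) * ‖𝓕 G x‖ₑ ^ 2) (nhdsWithin 1 (Iio 1))
      (nhds (ENNReal.ofReal (1 ^ 2) * ∫⁻ x, ENNReal.ofReal (B x ^ 2) * ‖𝓕 G x‖ₑ ^ 2)) := by
    refine ENNReal.Tendsto.mul_const ?_ (Or.inl (by simp))
    exact ((ENNReal.continuous_ofReal.comp (continuous_pow 2)).tendsto 1).mono_left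
      nhdsWithin_le_nhds
  have := le_of_tendsto hlim (by
    filter_upwards [Ioo_mem_nhdsLT (zero_lt_one' ℝ)] with θ h using hθ θ h)
  simpa using this

/-! ### The short-time Fourier transform with a compactly supported window -/

theorem hasCompactSupport_of_abs_gt {p : ℝ → ℂ} (hps : ∀ y, 1 < |y| → p y = 0) :
    HasCompactSupport p :=
  HasCompactSupport.intro (isCompact_Icc (a := -1) (b := (1 : ℝ))) fun y hy => hps y (by
    by_contra! h
    exact hy (abs_le.1 h))

/-- There is a continuous window supported in `[-1, 1]`, normalised in `L²`, whose Fourier transform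
has even modulus, has all moments, and does not vanish identically on `[0, 1]`. -/
theorem exists_window : ∃ p : ℝ → ℂ, Continuous p ∧ (∀ y, 1 < |y| → p y = 0) ∧
    ∫⁻ y, ‖p y‖ₑ ^ 2 = 1 ∧ (∀ t, ‖𝓕 p (-t)‖ = ‖𝓕 p t‖) ∧
    (∀ n : ℕ, Integrable (fun t => |t| ^ n * ‖𝓕 p t‖ ^ 2)) ∧ 0 < ∫ t in (0 : ℝ)..1, ‖𝓕 p t‖ ^ 2 := by
  let b : ContDiffBump (0 : ℝ) := ⟨1 / 2, 1, by norm_num, by norm_num⟩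
  have hbc : Continuous b := b.continuous
  have hb2 : Integrable (fun x => b x ^ 2) := by
    refine Continuous.integrable_of_hasCompactSupport (by fun_prop) ?_
    exact b.hasCompactSupport.comp_left (g := fun r : ℝ => r ^ 2) (by simp)
  have hpos : ∀ {g : ℝ → ℝ}, Continuous g → (∀ x, 0 ≤ g x) → Integrable g → 0 < g 0 →
      0 < ∫ x, g x := fun {g} hc h0 hi hg => by
    refine (integral_pos_iff_support_of_nonneg h0 hi).2 ?_
    exact hc.isOpen_support.measure_pos volume ⟨0, hg.ne'⟩
  have hb0 : b 0 = 1 := b.one_of_mem_closedBall (by simp [b])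
  set c := ∫ x, b x ^ 2 with hc
  have hcpos : 0 < c := hpos (by fun_prop) (fun x => by positivity) hb2 (by rw [hb0]; norm_num)
  let φ : ℝ → ℝ := fun y => (Real.sqrt c)⁻¹ * b y
  have hsc : 0 < Real.sqrt c := Real.sqrt_pos.2 hcpos
  have hφs : HasCompactSupport φ := b.hasCompactSupport.mul_left
  have hφd : ContDiff ℝ (⊤ : ℕ∞) φ := contDiff_const.mul b.contDiff
  have hφc : Continuous φ := hφd.continuous
  let Φ : SchwartzMap ℝ ℂ := (hφs.comp_left (g := fun r : ℝ => (r : ℂ))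
    Complex.ofReal_zero).toSchwartzMap (Complex.ofRealCLM.contDiff.comp hφd)
  have hΦ : (Φ : ℝ → ℂ) = fun y => (φ y : ℂ) := rfl
  have hF : 𝓕 (Φ : ℝ → ℂ) = ((𝓕 Φ : SchwartzMap ℝ ℂ) : ℝ → ℂ) := (SchwartzMap.fourier_coe Φ).symm
  refine ⟨Φ, Φ.continuous, fun y hy => ?_, ?_, fun t => ?_, fun n => ?_, ?_⟩
  · have : b y = 0 := b.zero_of_le_dist (by simpa [b] using hy.le)
    simp [hΦ, φ, this]
  · have h1 : ∀ y, ‖Φ y‖ₑ ^ 2 = ENNReal.ofReal (c⁻¹ * b y ^ 2) := fun y => by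
      rw [← ofReal_norm, ← ENNReal.ofReal_pow (norm_nonneg _), hΦ]
      congr 1
      simp only [φ, Complex.norm_real, Real.norm_eq_abs, sq_abs, mul_pow, inv_pow,
        Real.sq_sqrt hcpos.le]
    simp only [h1]
    rw [← ofReal_integral_eq_lintegral_ofReal (hb2.const_mul _)
      (Eventually.of_forall fun y => by positivity), integral_const_mul, ← hc,
      inv_mul_cancel₀ hcpos.ne', ENNReal.ofReal_one]
  · have : 𝓕 (Φ : ℝ → ℂ) (-t) = (starRingEnd ℂ) (𝓕 (Φ : ℝ → ℂ) t) := by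
      rw [Real.fourier_real_eq, Real.fourier_real_eq, ← integral_conj]
      refine integral_congr_ae (Eventually.of_forall fun y => ?_)
      simp only [Circle.smul_def, smul_eq_mul, map_mul, hΦ, Complex.conj_ofReal]
      congr 1
      rw [← Circle.coe_inv_eq_conj, ← AddChar.map_neg_eq_inv]
      congr 2
      ring
    rw [this, RCLike.norm_conj]
  · rw [hF]
    obtain ⟨C, hC⟩ := (𝓕 Φ : SchwartzMap ℝ ℂ).decay 0 0
    have hC' : ∀ t, ‖(𝓕 Φ : SchwartzMap ℝ ℂ) t‖ ≤ C := fun t => by simpa using hC.2 t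
    refine (((𝓕 Φ : SchwartzMap ℝ ℂ).integrable_pow_mul volume n).mul_const C).mono'
      (by fun_prop) (Eventually.of_forall fun t => ?_)
    rw [Real.norm_of_nonneg (by positivity), pow_two, ← mul_assoc, Real.norm_eq_abs]
    gcongr
    exact hC' t
  · rw [hF]
    have h0 : (𝓕 Φ : SchwartzMap ℝ ℂ) 0 = ((∫ y, φ y : ℝ) : ℂ) := by
      rw [← hF, Real.fourier_real_eq, ← integral_complex_ofReal]
      simp [hΦ]
    have h1 : 0 < ∫ y, φ y := by
      refine hpos hφc (fun y => mul_nonneg (by positivity) b.nonneg)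
        (hφc.integrable_of_hasCompactSupport hφs) ?_
      simp only [φ, hb0]; positivity
    refine intervalIntegral.integral_pos zero_lt_one (by fun_prop) (fun t _ => by positivity)
      ⟨0, by simp, ?_⟩
    rw [h0, Complex.norm_real]
    exact pow_pos (norm_pos_iff.2 h1.ne') 2

/-- The short-time Fourier transform of `f` with window `p`, regarded as a function of the position
`x` for a fixed frequency `s`. As a function of `s` it is a Fourier transform; as a function of `x`
it is a convolution of `f` with a modulated window. -/
noncomputable def shortTimeFourier (p f : ℝ → ℂ) (s x : ℝ) : ℂ := 𝓕 (fun y => p y * f (x - y)) s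

theorem shortTimeFourier_eq_convolution (p f : ℝ → ℂ) (s : ℝ) :
    shortTimeFourier p f s =
      convolution (fun y => Real.fourierChar (-(y * s)) • p y) f (ContinuousLinearMap.mul ℂ ℂ) := by
  ext x
  rw [shortTimeFourier, Real.fourier_real_eq]
  simp [convolution, Circle.smul_def, mul_assoc]

section

variable {p f : ℝ → ℂ}

theorem integrable_modulate (hp : Integrable p) (s : ℝ) :
    Integrable (fun y => Real.fourierChar (-(y * s)) • p y) := by
  simpa [mul_comm] using (Real.fourierIntegral_convergent_iff s).2 hp

theorem integrable_shortTimeFourier (hp : Integrable p) (hf : Integrable f) (s : ℝ) :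
    Integrable (shortTimeFourier p f s) := by
  rw [shortTimeFourier_eq_convolution]
  exact (integrable_modulate hp s).integrable_convolution _ hf

theorem fourier_shortTimeFourier (hp : Integrable p) (hf : Integrable f) (s ξ : ℝ) :
    𝓕 (shortTimeFourier p f s) ξ = 𝓕 p (ξ + s) * 𝓕 f ξ := by
  rw [shortTimeFourier_eq_convolution,
    Real.fourier_mul_convolution_eq (integrable_modulate hp s) hf]
  congr 1
  rw [Real.fourier_real_eq, Real.fourier_real_eq]
  refine integral_congr_ae (Eventually.of_forall fun y => ?_)
  simp only [smul_smul, ← AddChar.map_add_eq_mul]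
  congr 2
  ring

theorem memLp_two_shortTimeFourier (hpc : Continuous p) (hps : ∀ y, 1 < |y| → p y = 0)
    (hp : Integrable p) (hf : Integrable f) (s : ℝ) : MemLp (shortTimeFourier p f s) 2 := by
  obtain ⟨C, hC⟩ : ∃ C, ∀ y, ‖p y‖ ≤ C :=
    hpc.bounded_above_of_compact_support (hasCompactSupport_of_abs_gt hps)
  have hi := integrable_shortTimeFourier hp hf s
  have hbound : ∀ x, ‖shortTimeFourier p f s x‖ ≤ C * ∫ y, ‖f y‖ := fun x => by
    have h1 : Integrable (fun y => C * ‖f (x - y)‖) := (hf.comp_sub_left x).norm.const_mul C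
    refine (VectorFourier.norm_fourierIntegral_le_integral_norm _ _ _ _ _).trans ?_
    rw [← integral_sub_left_eq_self (fun y => ‖f y‖) volume x, ← integral_const_mul]
    refine integral_mono_of_nonneg (Eventually.of_forall fun y => norm_nonneg _) h1
      (Eventually.of_forall fun y => ?_)
    simp only [norm_mul]
    gcongr
    exact hC y
  refine (memLp_two_iff_integrable_sq_norm hi.aestronglyMeasurable).2 ?_
  refine (hi.norm.const_mul (C * ∫ y, ‖f y‖)).mono' (hi.aestronglyMeasurable.norm.pow 2)
    (Eventually.of_forall fun x => ?_)
  rw [Real.norm_of_nonneg (by positivity), pow_two]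
  gcongr
  exact hbound x

theorem measurable_shortTimeFourier (hpc : Continuous p) (hf : Continuous f) :
    Measurable (fun z : ℝ × ℝ => shortTimeFourier p f z.1 z.2) := by
  have h : StronglyMeasurable (fun q : (ℝ × ℝ) × ℝ =>
      Real.fourierChar (-(q.2 * q.1.1)) • (p q.2 * f (q.1.2 - q.2))) := by
    refine Continuous.stronglyMeasurable ?_
    have : Continuous (fun q : (ℝ × ℝ) × ℝ => Real.fourierChar (-(q.2 * q.1.1))) :=
      Real.continuous_fourierChar.comp (by fun_prop)
    exact this.smul (by fun_prop)
  have := (h.integral_prod_right' (ν := volume)).measurable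
  simpa only [shortTimeFourier, Real.fourier_real_eq] using this

/-- Plancherel's identity in the frequency variable. -/
theorem lintegral_shortTimeFourier (hpc : Continuous p) (hps : ∀ y, 1 < |y| → p y = 0)
    (hf : Continuous f) (x : ℝ) :
    ∫⁻ s, ‖shortTimeFourier p f s x‖ₑ ^ 2 = ∫⁻ y, ‖p y‖ₑ ^ 2 * ‖f (x - y)‖ₑ ^ 2 := by
  have hc : Continuous (fun y => p y * f (x - y)) := by fun_prop
  have hs : HasCompactSupport (fun y => p y * f (x - y)) :=
    hasCompactSupport_of_abs_gt fun y hy => by rw [hps y hy, zero_mul]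
  refine (lintegral_enorm_sq_fourier (hc.integrable_of_hasCompactSupport hs)
    (hc.memLp_of_hasCompactSupport hs)).trans ?_
  simp only [enorm_mul, mul_pow]

end

/-! ### The Fourier symmetric Sobolev space -/

namespace FourierSobolev

variable {f : ℝ → ℂ}

theorem continuous_fourier (hf : f ∈ FourierSobolev) : Continuous (𝓕 f) :=
  VectorFourier.fourierIntegral_continuous Real.continuous_fourierChar
    (by exact continuous_inner) (integrable hf)

theorem memLp_two_fourier (hf : f ∈ FourierSobolev) : MemLp (𝓕 f) 2 := by
  have hc := (continuous_fourier hf).aestronglyMeasurable (μ := volume)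
  refine (memLp_two_iff_integrable_sq_norm hc).2 (hf.2.2.2.mono' (hc.norm.pow 2)
    (Eventually.of_forall fun x => ?_))
  rw [Real.norm_of_nonneg (by positivity)]
  nlinarith [mul_nonneg (sq_nonneg x) (sq_nonneg ‖𝓕 f x‖)]

/-- The Fourier transform is integrable, by the Cauchy-Schwarz inequality with the weight. -/
theorem integrable_fourier (hf : f ∈ FourierSobolev) : Integrable (𝓕 f) := by
  refine Integrable.mono' (hf.2.2.2.add integrable_inv_one_add_sq)
    (continuous_fourier hf).aestronglyMeasurable (Eventually.of_forall fun x => ?_)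
  have hx : (0 : ℝ) < 1 + x ^ 2 := by positivity
  have key : (1 + x ^ 2) * ‖𝓕 f x‖ ^ 2 + (1 + x ^ 2)⁻¹ - ‖𝓕 f x‖
      = (1 + x ^ 2) * (‖𝓕 f x‖ - (1 + x ^ 2)⁻¹) ^ 2 + ‖𝓕 f x‖ := by
    field_simp
    ring
  have h2 : 0 ≤ (1 + x ^ 2) * (‖𝓕 f x‖ - (1 + x ^ 2)⁻¹) ^ 2 + ‖𝓕 f x‖ := by positivity
  simp only [Pi.add_apply]
  linarith

theorem fourier_conj_fourier (hf : f ∈ FourierSobolev) :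
    𝓕 (fun ξ => (starRingEnd ℂ) (𝓕 f ξ)) = fun x => (starRingEnd ℂ) (f x) := by
  ext x
  have h := congrFun (hf.1.fourierInv_fourier_eq (integrable hf) (integrable_fourier hf)) x
  rw [← h, Real.fourierInv_eq, Real.fourier_eq, ← integral_conj]
  refine integral_congr_ae (Eventually.of_forall fun y => ?_)
  simp only [Circle.smul_def, smul_eq_mul, map_mul]
  congr 1
  rw [← Circle.coe_inv_eq_conj, ← AddChar.map_neg_eq_inv]

/-- The conjugate of the Fourier transform stays in the space, and so exchanges the roles of the
zeros of a function and those of its Fourier transform. -/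
theorem conj_fourier_mem (hf : f ∈ FourierSobolev) :
    (fun ξ => (starRingEnd ℂ) (𝓕 f ξ)) ∈ FourierSobolev := by
  have hc := Complex.continuous_conj.comp (continuous_fourier hf)
  refine ⟨hc, (memLp_two_fourier hf).of_le hc.aestronglyMeasurable
    (Eventually.of_forall fun x => by simp), by simpa using hf.2.2.2, ?_⟩
  rw [fourier_conj_fourier hf]
  simpa using hf.2.2.1

/-- If `f` vanishes on an ordered sequence with gaps at most `1 / (2 B)`, then `B f` is dominated
by `ξ 𝓕 f` in `L²`. -/
theorem lintegral_sq_mul_le (hf : f ∈ FourierSobolev) {a : ℤ → ℝ} (ha : IsOrderedSequence a)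
    (hz : ∀ j, f (a j) = 0) {B : ℝ → ℝ} (hB0 : ∀ x, 0 ≤ B x)
    (hB : ∀ j, ∀ x ∈ Ioc (a j) (a (j + 1)), B x * (a (j + 1) - a j) ≤ 1 / 2) :
    ∫⁻ x, ENNReal.ofReal (B x ^ 2) * ‖f x‖ₑ ^ 2 ≤
      ∫⁻ ξ, ENNReal.ofReal (ξ ^ 2) * ‖𝓕 f ξ‖ₑ ^ 2 := by
  have hi := integrable_fourier hf
  have h := hf.1.fourierInv_fourier_eq (integrable hf) hi
  rw [Real.fourierInv_eq_fourier_comp_neg] at h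
  have := lintegral_sq_mul_fourier_le hi.comp_neg ha (by rwa [h]) hB0 hB
  rw [h] at this
  refine this.trans (le_of_eq ?_)
  rw [← lintegral_neg_eq_self]
  simp

end FourierSobolev

/-! ### The uniqueness criterion -/

/-- The inequality for one localised piece `v` of `f`: its position weight `A` is bounded below by
a parabola, and the second moment of `v` dominates the weight `B` on the frequency side. -/
theorem localized_inequality {v G : ℝ → ℂ} (hv : MemLp v 2) (hvi : Integrable v)
    (hG : 𝓕 v = G) {A B : ℝ → ℝ} (hB : Measurable B)
    (hM : ∫⁻ ξ, ENNReal.ofReal (B ξ ^ 2) * ‖G ξ‖ₑ ^ 2 ≤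
      ∫⁻ x, ENNReal.ofReal (x ^ 2) * ‖v x‖ₑ ^ 2)
    {s h ρ : ℝ} (hh : 0 ≤ h) (hA' : ∀ x, s ^ 2 + h * (x ^ 2 - ρ ^ 2) ≤ A x) :
    ∫⁻ ξ, (ENNReal.ofReal (s ^ 2) + ENNReal.ofReal (h * (B ξ ^ 2 - ρ ^ 2))) * ‖G ξ‖ₑ ^ 2 ≤
      (∫⁻ x, ENNReal.ofReal (A x) * ‖v x‖ₑ ^ 2) +
        ∫⁻ ξ, ENNReal.ofReal (h * (ρ ^ 2 - B ξ ^ 2)) * ‖G ξ‖ₑ ^ 2 := by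
  have hGc : Continuous G := hG ▸ VectorFourier.fourierIntegral_continuous
    Real.continuous_fourierChar (by exact continuous_inner) hvi
  have hGm : Measurable G := hGc.measurable
  have hvm : AEMeasurable (fun x => ‖v x‖ₑ ^ 2) :=
    (hvi.aestronglyMeasurable.enorm).pow_const 2
  have hpl : ∫⁻ ξ, ‖G ξ‖ₑ ^ 2 = ∫⁻ x, ‖v x‖ₑ ^ 2 := hG ▸ lintegral_enorm_sq_fourier hvi hv
  have hfin : ∫⁻ ξ, ‖G ξ‖ₑ ^ 2 ≠ ⊤ := by
    have := (hv.integrable_norm_pow two_ne_zero).2.ne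
    rw [hpl]
    simpa [enorm_pow] using this
  set N := ∫⁻ ξ, ‖G ξ‖ₑ ^ 2 with hN
  -- the parabola bound, integrated against `|v|²`
  have h1 : ENNReal.ofReal (s ^ 2) * N + ENNReal.ofReal h *
      ∫⁻ ξ, ENNReal.ofReal (B ξ ^ 2) * ‖G ξ‖ₑ ^ 2 ≤
      (∫⁻ x, ENNReal.ofReal (A x) * ‖v x‖ₑ ^ 2) + ENNReal.ofReal (h * ρ ^ 2) * N := by
    calc _ ≤ ENNReal.ofReal (s ^ 2) * N + ENNReal.ofReal h *
            ∫⁻ x, ENNReal.ofReal (x ^ 2) * ‖v x‖ₑ ^ 2 := by gcongr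
      _ = ∫⁻ x, (ENNReal.ofReal (s ^ 2) + ENNReal.ofReal h * ENNReal.ofReal (x ^ 2)) *
            ‖v x‖ₑ ^ 2 := by
          rw [hpl, ← lintegral_const_mul'' _ hvm, ← lintegral_const_mul'' _ (by fun_prop),
            ← lintegral_add_left' (by fun_prop)]
          exact lintegral_congr fun x => by ring
      _ ≤ ∫⁻ x, (ENNReal.ofReal (A x) + ENNReal.ofReal (h * ρ ^ 2)) * ‖v x‖ₑ ^ 2 := by
          refine lintegral_mono fun x => ?_
          refine mul_le_mul' ?_ le_rfl
          rw [← ENNReal.ofReal_mul hh, ← ENNReal.ofReal_add (by positivity) (by positivity)]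
          refine le_trans (ENNReal.ofReal_le_ofReal ?_) ENNReal.ofReal_add_le
          linarith [hA' x]
      _ = _ := by
          simp only [add_mul]
          rw [lintegral_add_right' _ (by fun_prop), lintegral_const_mul'' _ hvm, hpl]
  -- the decomposition of `h (B² - ρ²)` into its positive and negative parts
  have h2 : (∫⁻ ξ, (ENNReal.ofReal (s ^ 2) + ENNReal.ofReal (h * (B ξ ^ 2 - ρ ^ 2))) * ‖G ξ‖ₑ ^ 2) +
      ENNReal.ofReal (h * ρ ^ 2) * N = (ENNReal.ofReal (s ^ 2) * N + ENNReal.ofReal h *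
      ∫⁻ ξ, ENNReal.ofReal (B ξ ^ 2) * ‖G ξ‖ₑ ^ 2) +
        ∫⁻ ξ, ENNReal.ofReal (h * (ρ ^ 2 - B ξ ^ 2)) * ‖G ξ‖ₑ ^ 2 := by
    rw [hN, ← lintegral_const_mul _ (by fun_prop), ← lintegral_const_mul _ (by fun_prop),
      ← lintegral_const_mul _ (by fun_prop), ← lintegral_add_left (by fun_prop),
      ← lintegral_add_left (by fun_prop), ← lintegral_add_left (by fun_prop)]
    refine lintegral_congr fun ξ => ?_
    simp only [← mul_assoc, ← add_mul]
    congr 1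
    rw [← ENNReal.ofReal_mul hh, add_assoc, add_assoc]
    congr 1
    rcases le_total 0 (h * (B ξ ^ 2 - ρ ^ 2)) with h0 | h0
    · rw [ENNReal.ofReal_of_nonpos (p := h * (ρ ^ 2 - B ξ ^ 2)) (by linarith), add_zero,
        ← ENNReal.ofReal_add h0 (by positivity)]
      congr 1; ring
    · rw [ENNReal.ofReal_of_nonpos h0, zero_add, ← ENNReal.ofReal_add (by positivity)
        (by linarith)]
      congr 1; ring
  have hfin' : ENNReal.ofReal (h * ρ ^ 2) * N ≠ ⊤ := ENNReal.mul_ne_top ENNReal.ofReal_ne_top hfin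
  rw [← ENNReal.add_le_add_iff_right hfin', h2]
  refine (add_le_add_left h1 _).trans (le_of_eq ?_)
  ring

/-- The uniqueness criterion: the localised inequalities are integrated over all frequencies `s`.
Compared with `∫ ξ² |𝓕 f|²`, the total gains the variance `m` of the window, while the terms
containing `h` contribute nonnegatively at each `ξ`. -/
theorem eq_zero_of_kernel_le {f : ℝ → ℂ} (hf : f ∈ FourierSobolev) {p : ℝ → ℂ}
    (hpc : Continuous p) (hps : ∀ y, 1 < |y| → p y = 0) (hp2 : ∫⁻ y, ‖p y‖ₑ ^ 2 = 1)
    {lam mu : ℤ → ℝ} (hlam : IsOrderedSequence lam) (hmu : IsOrderedSequence mu)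
    (hflam : ∀ j, f (lam j) = 0) (hfmu : ∀ j, 𝓕 f (mu j) = 0)
    {A B₁ B h ρ : ℝ → ℝ} (hA : Measurable A) (hB₁ : Measurable B₁) (hB : Measurable B)
    (hh : Measurable h) (hρ : Measurable ρ) (hh0 : ∀ s, 0 ≤ h s) (hB₁0 : ∀ x, 0 ≤ B₁ x)
    (hB0 : ∀ x, 0 ≤ B x)
    (hlamB : ∀ j, ∀ x ∈ Ioc (lam j) (lam (j + 1)), B₁ x * (lam (j + 1) - lam j) ≤ 1 / 2)
    (hmuB : ∀ j, ∀ x ∈ Ioc (mu j) (mu (j + 1)), B x * (mu (j + 1) - mu j) ≤ 1 / 2)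
    (hparab : ∀ s x, s ^ 2 + h s * (x ^ 2 - ρ s ^ 2) ≤ A x)
    (hAB : ∀ x y, |y| ≤ 1 → A x ≤ B₁ (x - y) ^ 2) {m : ℝ} (hm : 0 < m)
    (hmom : ∀ ξ, ∫⁻ s, ENNReal.ofReal (s ^ 2) * ‖𝓕 p (ξ + s)‖ₑ ^ 2 = ENNReal.ofReal (ξ ^ 2 + m))
    (hker : ∀ ξ, ∫⁻ s, ENNReal.ofReal (h s * (ρ s ^ 2 - B ξ ^ 2)) * ‖𝓕 p (ξ + s)‖ₑ ^ 2 ≤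
      ∫⁻ s, ENNReal.ofReal (h s * (B ξ ^ 2 - ρ s ^ 2)) * ‖𝓕 p (ξ + s)‖ₑ ^ 2)
    {C : ℝ} (hC : 0 ≤ C)
    (hfin : ∀ ξ, ∫⁻ s, ENNReal.ofReal (h s * (ρ s ^ 2 - B ξ ^ 2)) * ‖𝓕 p (ξ + s)‖ₑ ^ 2 ≤
      ENNReal.ofReal (C * (1 + ξ ^ 2))) (x : ℝ) : f x = 0 := by
  have hfi := FourierSobolev.integrable hf
  have hp : Integrable p := hpc.integrable_of_hasCompactSupport (hasCompactSupport_of_abs_gt hps)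
  have hqm : Measurable (𝓕 p) := (VectorFourier.fourierIntegral_continuous
    Real.continuous_fourierChar (by exact continuous_inner) hp).measurable
  have hgm : Measurable (𝓕 f) := (FourierSobolev.continuous_fourier hf).measurable
  have hfm : Measurable f := hf.1.measurable
  set I := ∫⁻ ξ, ENNReal.ofReal (ξ ^ 2) * ‖𝓕 f ξ‖ₑ ^ 2 with hI
  have hW : ∫⁻ ξ, ENNReal.ofReal (1 + ξ ^ 2) * ‖𝓕 f ξ‖ₑ ^ 2 ≠ ⊤ := by
    have := hf.2.2.2.2
    rw [hasFiniteIntegral_iff_ofReal (Eventually.of_forall fun x => by positivity)] at this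
    refine ((lintegral_congr fun ξ => ?_).trans_lt this).ne
    rw [ENNReal.ofReal_mul (by positivity), ENNReal.ofReal_pow (norm_nonneg _), ofReal_norm]
  have hIfin : I ≠ ⊤ := by
    refine ne_top_of_le_ne_top hW (lintegral_mono fun ξ => ?_)
    gcongr
    linarith
  -- the inequality for each frequency
  have hloc : ∀ s, ∫⁻ ξ, (ENNReal.ofReal (s ^ 2) + ENNReal.ofReal (h s * (B ξ ^ 2 - ρ s ^ 2))) *
      ‖𝓕 p (ξ + s) * 𝓕 f ξ‖ₑ ^ 2 ≤
      (∫⁻ x, ENNReal.ofReal (A x) * ‖shortTimeFourier p f s x‖ₑ ^ 2) +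
        ∫⁻ ξ, ENNReal.ofReal (h s * (ρ s ^ 2 - B ξ ^ 2)) * ‖𝓕 p (ξ + s) * 𝓕 f ξ‖ₑ ^ 2 := by
    intro s
    have hF : 𝓕 (shortTimeFourier p f s) = fun ξ => 𝓕 p (ξ + s) * 𝓕 f ξ :=
      funext fun ξ => fourier_shortTimeFourier hp hfi s ξ
    have hvi := integrable_shortTimeFourier hp hfi s
    have hM := lintegral_sq_mul_fourier_le hvi hmu (fun j => by
      rw [hF]; simp only [hfmu, mul_zero]) hB0 hmuB
    rw [hF] at hM
    exact localized_inequality (memLp_two_shortTimeFourier hpc hps hp hfi s) hvi hF hB hM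
      (hh0 s) (hparab s)
  -- the position side, integrated over frequencies
  have hE : ∫⁻ s, ∫⁻ x, ENNReal.ofReal (A x) * ‖shortTimeFourier p f s x‖ₑ ^ 2 ≤ I := by
    have hmeas := measurable_shortTimeFourier hpc hf.1
    rw [lintegral_lintegral_swap (by
      exact ((hA.comp measurable_snd).ennreal_ofReal.mul (hmeas.enorm.pow_const 2)).aemeasurable)]
    calc ∫⁻ x, ∫⁻ s, ENNReal.ofReal (A x) * ‖shortTimeFourier p f s x‖ₑ ^ 2
        = ∫⁻ x, ∫⁻ y, ENNReal.ofReal (A x) * (‖p y‖ₑ ^ 2 * ‖f (x - y)‖ₑ ^ 2) := by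
          refine lintegral_congr fun x => ?_
          rw [lintegral_const_mul' _ _ ENNReal.ofReal_ne_top,
            lintegral_const_mul' _ _ ENNReal.ofReal_ne_top,
            lintegral_shortTimeFourier hpc hps hf.1]
      _ ≤ ∫⁻ x, ∫⁻ y, ‖p y‖ₑ ^ 2 * (ENNReal.ofReal (B₁ (x - y) ^ 2) * ‖f (x - y)‖ₑ ^ 2) := by
          refine lintegral_mono fun x => lintegral_mono fun y => ?_
          rcases le_or_gt |y| 1 with hy | hy
          · rw [mul_left_comm]
            gcongr
            exact hAB x y hy
          · simp [hps y hy]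
      _ = ∫⁻ y, ‖p y‖ₑ ^ 2 * ∫⁻ x, ENNReal.ofReal (B₁ x ^ 2) * ‖f x‖ₑ ^ 2 := by
          rw [lintegral_lintegral_swap (by fun_prop)]
          refine lintegral_congr fun y => ?_
          rw [lintegral_const_mul _ (by fun_prop)]
          congr 1
          exact lintegral_sub_right_eq_self (fun x => ENNReal.ofReal (B₁ x ^ 2) * ‖f x‖ₑ ^ 2) y
      _ = ∫⁻ x, ENNReal.ofReal (B₁ x ^ 2) * ‖f x‖ₑ ^ 2 := by
          rw [lintegral_mul_const _ (by fun_prop), hp2, one_mul]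
      _ ≤ I := FourierSobolev.lintegral_sq_mul_le hf hlam hflam hB₁0 hlamB
  -- the frequency side
  have hswap : ∀ k : ℝ → ℝ → ENNReal, Measurable (Function.uncurry k) →
      ∫⁻ s, ∫⁻ ξ, k s ξ * ‖𝓕 p (ξ + s) * 𝓕 f ξ‖ₑ ^ 2 =
        ∫⁻ ξ, (∫⁻ s, k s ξ * ‖𝓕 p (ξ + s)‖ₑ ^ 2) * ‖𝓕 f ξ‖ₑ ^ 2 := by
    intro k hk
    have hk' : Measurable (fun z : ℝ × ℝ => k z.1 z.2) := hk
    rw [lintegral_lintegral_swap (by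
      refine (hk'.mul ?_).aemeasurable
      fun_prop)]
    refine lintegral_congr fun ξ => ?_
    have : Measurable (fun s => k s ξ) := hk'.comp (measurable_id.prodMk measurable_const)
    rw [← lintegral_mul_const _ (by fun_prop)]
    refine lintegral_congr fun s => ?_
    rw [enorm_mul, mul_pow, mul_assoc]
  set Neg := ∫⁻ s, ∫⁻ ξ, ENNReal.ofReal (h s * (ρ s ^ 2 - B ξ ^ 2)) *
    ‖𝓕 p (ξ + s) * 𝓕 f ξ‖ₑ ^ 2 with hNeg
  have hNegfin : Neg ≠ ⊤ := by
    rw [hNeg, hswap (fun s ξ => ENNReal.ofReal (h s * (ρ s ^ 2 - B ξ ^ 2))) (by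
      unfold Function.uncurry; fun_prop)]
    refine ne_top_of_le_ne_top (ENNReal.mul_ne_top (ENNReal.ofReal_ne_top (r := C)) hW) ?_
    rw [← lintegral_const_mul _ (by fun_prop)]
    refine lintegral_mono fun ξ => ?_
    rw [← mul_assoc, ← ENNReal.ofReal_mul hC]
    gcongr
    exact hfin ξ
  have hmain : (∫⁻ ξ, ENNReal.ofReal (ξ ^ 2 + m) * ‖𝓕 f ξ‖ₑ ^ 2) + Neg ≤ I + Neg := by
    calc (∫⁻ ξ, ENNReal.ofReal (ξ ^ 2 + m) * ‖𝓕 f ξ‖ₑ ^ 2) + Neg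
        ≤ ∫⁻ ξ, (∫⁻ s, (ENNReal.ofReal (s ^ 2) + ENNReal.ofReal (h s * (B ξ ^ 2 - ρ s ^ 2))) *
            ‖𝓕 p (ξ + s)‖ₑ ^ 2) * ‖𝓕 f ξ‖ₑ ^ 2 := by
          rw [hNeg, hswap (fun s ξ => ENNReal.ofReal (h s * (ρ s ^ 2 - B ξ ^ 2))) (by
            unfold Function.uncurry; fun_prop), ← lintegral_add_left (by fun_prop)]
          refine lintegral_mono fun ξ => ?_
          simp only [add_mul]
          rw [lintegral_add_left (by fun_prop), add_mul, hmom]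
          exact add_le_add le_rfl (mul_le_mul' (hker ξ) le_rfl)
      _ = ∫⁻ s, ∫⁻ ξ, (ENNReal.ofReal (s ^ 2) + ENNReal.ofReal (h s * (B ξ ^ 2 - ρ s ^ 2))) *
            ‖𝓕 p (ξ + s) * 𝓕 f ξ‖ₑ ^ 2 := by
          rw [hswap (fun s ξ => ENNReal.ofReal (s ^ 2) +
            ENNReal.ofReal (h s * (B ξ ^ 2 - ρ s ^ 2))) (by
            unfold Function.uncurry; fun_prop)]
      _ ≤ ∫⁻ s, ((∫⁻ x, ENNReal.ofReal (A x) * ‖shortTimeFourier p f s x‖ₑ ^ 2) +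
            ∫⁻ ξ, ENNReal.ofReal (h s * (ρ s ^ 2 - B ξ ^ 2)) *
              ‖𝓕 p (ξ + s) * 𝓕 f ξ‖ₑ ^ 2) := lintegral_mono hloc
      _ = (∫⁻ s, ∫⁻ x, ENNReal.ofReal (A x) * ‖shortTimeFourier p f s x‖ₑ ^ 2) + Neg := by
          refine lintegral_add_right _ (Measurable.lintegral_prod_right' (f := fun z : ℝ × ℝ =>
            ENNReal.ofReal (h z.1 * (ρ z.1 ^ 2 - B z.2 ^ 2)) *
              ‖𝓕 p (z.2 + z.1) * 𝓕 f z.2‖ₑ ^ 2) (by fun_prop))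
      _ ≤ I + Neg := by gcongr
  rw [ENNReal.add_le_add_iff_right hNegfin] at hmain
  have hsplit : ∫⁻ ξ, ENNReal.ofReal (ξ ^ 2 + m) * ‖𝓕 f ξ‖ₑ ^ 2
      = I + ENNReal.ofReal m * ∫⁻ ξ, ‖𝓕 f ξ‖ₑ ^ 2 := by
    rw [hI, ← lintegral_const_mul _ (by fun_prop), ← lintegral_add_left (by fun_prop)]
    refine lintegral_congr fun ξ => ?_
    rw [ENNReal.ofReal_add (by positivity) hm.le, add_mul]
  have hzero : ENNReal.ofReal m * ∫⁻ ξ, ‖𝓕 f ξ‖ₑ ^ 2 = 0 := by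
    rw [hsplit] at hmain
    have : I + ENNReal.ofReal m * ∫⁻ ξ, ‖𝓕 f ξ‖ₑ ^ 2 ≤ I + 0 := by simpa using hmain
    exact le_antisymm ((ENNReal.add_le_add_iff_left hIfin).1 this) zero_le
  have hzero' : ∫⁻ ξ, ‖𝓕 f ξ‖ₑ ^ 2 = 0 := by
    rcases mul_eq_zero.1 hzero with h0 | h0
    · exact absurd (ENNReal.ofReal_eq_zero.1 h0) (not_le.2 hm)
    · exact h0
  rw [lintegral_enorm_sq_fourier hfi hf.2.1, lintegral_eq_zero_iff (by fun_prop)] at hzero'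
  have hae : f =ᵐ[volume] fun _ => 0 := by
    filter_upwards [hzero'] with x hx
    simpa using hx
  exact congrFun ((Continuous.ae_eq_iff_eq volume hf.1 continuous_const).1 hae) x

/-! ### The kernel inequality -/

/-- The second moment of a translate of an even probability density. -/
theorem lintegral_sq_mul_comp_add {w : ℝ → ℝ} (hw0 : ∀ t, 0 ≤ w t) (hw : ∀ t, w (-t) = w t)
    (hint : ∀ n : ℕ, Integrable (fun t => |t| ^ n * w t)) (h1 : ∫ t, w t = 1) (ξ : ℝ) :
    ∫⁻ s, ENNReal.ofReal (s ^ 2) * ENNReal.ofReal (w (ξ + s)) =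
      ENNReal.ofReal (ξ ^ 2 + ∫ t, t ^ 2 * w t) := by
  have i0 : Integrable w := by simpa using hint 0
  have i1 : Integrable (fun t => t * w t) := by
    refine (hint 1).mono (continuous_id.aestronglyMeasurable.mul i0.aestronglyMeasurable)
      (Eventually.of_forall fun t => ?_)
    simp
  have i2 : Integrable (fun t => t ^ 2 * w t) := by simpa using hint 2
  have hodd : ∫ t, t * w t = 0 := by
    have h := integral_neg_eq_self (fun t => t * w t) volume
    simp only [hw, neg_mul, integral_neg] at h
    linarith
  have e : (fun t => (t - ξ) ^ 2 * w t)
      = fun t => (t ^ 2 * w t - 2 * ξ * (t * w t)) + ξ ^ 2 * w t := by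
    ext t; ring
  have i : Integrable (fun t => (t - ξ) ^ 2 * w t) := by
    rw [e]
    exact (i2.sub (i1.const_mul _)).add (i0.const_mul _)
  have hI : ∫ t, (t - ξ) ^ 2 * w t = ξ ^ 2 + ∫ t, t ^ 2 * w t := by
    have i' : Integrable (fun t => t ^ 2 * w t - 2 * ξ * (t * w t)) := i2.sub (i1.const_mul _)
    rw [e, integral_add i' (i0.const_mul _), integral_sub i2 (i1.const_mul _),
      integral_const_mul, integral_const_mul, hodd, h1]
    ring
  rw [← hI, ofReal_integral_eq_lintegral_ofReal i
    (Eventually.of_forall fun t => mul_nonneg (sq_nonneg _) (hw0 t)),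
    ← lintegral_add_left_eq_self (fun t => ENNReal.ofReal ((t - ξ) ^ 2 * w t)) ξ]
  refine lintegral_congr fun s => ?_
  rw [← ENNReal.ofReal_mul (sq_nonneg _), add_sub_cancel_left]

/-- The tails of an integrable function tend to zero. -/
theorem exists_setIntegral_abs_gt_le {F : ℝ → ℝ} (hF : Integrable F) {ε : ℝ} (hε : 0 < ε) :
    ∃ k : ℝ, 1 ≤ k ∧ ∫ t in {t : ℝ | k < |t|}, F t ≤ ε := by
  have hmeas : ∀ n : ℕ, MeasurableSet {t : ℝ | (n : ℝ) < |t|} := fun n =>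
    measurableSet_lt measurable_const continuous_abs.measurable
  have hanti : Antitone fun n : ℕ => {t : ℝ | (n : ℝ) < |t|} := fun m n hmn t ht =>
    show (m : ℝ) < |t| from lt_of_le_of_lt (Nat.cast_le.2 hmn) ht
  have h := tendsto_setIntegral_of_antitone hmeas hanti ⟨0, hF.integrableOn⟩
  have hempty : ⋂ n : ℕ, {t : ℝ | (n : ℝ) < |t|} = ∅ := by
    refine eq_empty_of_forall_notMem fun t ht => ?_
    obtain ⟨n, hn⟩ := exists_nat_ge |t|
    exact absurd (mem_iInter.1 ht n) (not_lt.2 hn)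
  rw [hempty, Measure.restrict_empty, integral_zero_measure] at h
  obtain ⟨n, hn, hn1⟩ := ((h.eventually_le_const hε).and (eventually_ge_atTop 1)).exists
  exact ⟨n, by exact_mod_cast hn1, hn⟩

/-- The properties of an increasing concave function `r` with `r 0 = 0` and of the slope `D` of its
inverse that make the total contribution of the tangent parabolas nonnegative. The number `L` is a
Lipschitz constant of `r`, and `growth` says that `D` grows at most linearly, up to a factor. -/
structure IsProfile (r D : ℝ → ℝ) (L : ℝ) : Prop where
  r_mono : MonotoneOn r (Ici 0)
  r_pos : ∀ σ, 0 < σ → 0 < r σ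
  D_mono : MonotoneOn D (Ici 0)
  D_pos : ∀ σ, 0 ≤ σ → 0 < D σ
  chord : ∀ σ τ, 0 < σ → σ ≤ τ → r τ * σ ≤ r σ * τ
  lipschitz : ∀ σ τ, 0 ≤ σ → σ ≤ τ → r τ - r σ ≤ L * (τ - σ)
  growth : ∀ σ τ, 1 ≤ σ → σ ≤ τ → D τ * σ ≤ 2 * D σ * τ

namespace IsProfile

/-- The coefficient of the square in the parabola that touches, at abscissa `r σ` and height `σ ^ 2`,
the square of the inverse function of `r`. -/
noncomputable def coeff (r D : ℝ → ℝ) (σ : ℝ) : ℝ := σ * D σ / r σ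

variable {r D : ℝ → ℝ} {L : ℝ}

theorem coeff_pos (hr : IsProfile r D L) {σ : ℝ} (hσ : 0 < σ) : 0 < coeff r D σ :=
  div_pos (mul_pos hσ (hr.D_pos σ hσ.le)) (hr.r_pos σ hσ)

theorem coeff_le (hr : IsProfile r D L) {σ τ : ℝ} (hσ : 0 < σ) (hτ : σ ≤ τ) :
    coeff r D σ ≤ coeff r D τ := by
  have h0 : 0 < τ := hσ.trans_le hτ
  rw [coeff, coeff, div_le_div_iff₀ (hr.r_pos σ hσ) (hr.r_pos τ h0)]
  calc σ * D σ * r τ = r τ * σ * D σ := by ring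
    _ ≤ r σ * τ * D σ := mul_le_mul_of_nonneg_right (hr.chord σ τ hσ hτ) (hr.D_pos σ hσ.le).le
    _ ≤ r σ * τ * D τ := mul_le_mul_of_nonneg_left (hr.D_mono hσ.le h0.le hτ)
        (mul_nonneg (hr.r_pos σ hσ).le h0.le)
    _ = _ := by ring

theorem coeff_growth (hr : IsProfile r D L) {σ τ : ℝ} (hσ : 1 ≤ σ) (hτ : σ ≤ τ) {c : ℝ}
    (hc : τ ≤ c * σ) : coeff r D τ ≤ 2 * c ^ 2 * coeff r D σ := by
  have h0 : 0 < σ := by linarith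
  have h1 : 0 < τ := by linarith
  have hD := hr.D_pos σ h0.le
  have hr0 := hr.r_pos σ h0
  have h2 : D τ ≤ 2 * D σ * c := by
    refine le_of_mul_le_mul_right ((hr.growth σ τ hσ hτ).trans ?_) h0
    rw [mul_assoc _ c]
    exact mul_le_mul_of_nonneg_left hc (by positivity)
  have hc0 : 0 < c := pos_of_mul_pos_left (h1.trans_le hc) h0.le
  calc coeff r D τ = τ * D τ / r τ := rfl
    _ ≤ τ * D τ / r σ := by
        have := hr.D_pos τ h1.le
        exact div_le_div_of_nonneg_left (by positivity) hr0 (hr.r_mono h0.le h1.le hτ)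
    _ ≤ (c * σ) * (2 * D σ * c) / r σ := by
        have := hr.D_pos τ h1.le
        gcongr
    _ = _ := by rw [coeff]; ring

theorem measurable_comp_max {u : ℝ → ℝ} (hu : MonotoneOn u (Ici 0)) :
    Measurable (fun s : ℝ => u (max |s| 1)) := by
  have : Monotone (fun v : ℝ => u (max v 1)) := fun x y hxy =>
    hu (mem_Ici.2 (zero_le_one.trans (le_max_right _ _)))
      (mem_Ici.2 (zero_le_one.trans (le_max_right _ _)))
      (max_le_max_right 1 hxy)
  exact this.measurable.comp continuous_abs.measurable

/-- The pointwise bound on the harmful part of the kernel: it lives on `|t| > k`, and is small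
compared with `coeff r D (max |ξ| 1) * r (|ξ| + k)`. -/
theorem coeff_mul_le (hr : IsProfile r D L) (hL : 0 ≤ L) {a k : ℝ} (ha : 0 < a) (hk : 1 ≤ k)
    (ξ t : ℝ) :
    coeff r D (max |t - ξ| 1) * (r (max |t - ξ| 1) ^ 2 - (a + r (|ξ| + k)) ^ 2) ≤
      {t : ℝ | k < |t|}.indicator (fun t => coeff r D (max |ξ| 1) * r (|ξ| + k) * (4 * L) *
        (1 + |t|) ^ 4) t := by
  have hξ := abs_nonneg ξ
  have habs : |t - ξ| ≤ |ξ| + |t| := by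
    rw [add_comm]; exact abs_sub t ξ
  have hσ0 : (0 : ℝ) < max |t - ξ| 1 := zero_lt_one.trans_le (le_max_right _ _)
  have hσr := (hr.r_pos _ hσ0).le
  have hrk := hr.r_pos (|ξ| + k) (by linarith)
  have hh := (hr.coeff_pos hσ0).le
  by_cases ht : k < |t|
  · rw [indicator_of_mem (show t ∈ {t : ℝ | k < |t|} from ht)]
    have hσ : max |t - ξ| 1 ≤ |ξ| + |t| := max_le habs (by linarith)
    have hξ1 : (1 : ℝ) ≤ max |ξ| 1 := le_max_right _ _
    have hξσ : max |ξ| 1 ≤ |ξ| + |t| := max_le (by linarith) (by linarith)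
    have hc : |ξ| + |t| ≤ (1 + |t|) * max |ξ| 1 := by
      nlinarith [le_max_left |ξ| 1, abs_nonneg t]
    have h1 : coeff r D (max |t - ξ| 1) ≤ 2 * (1 + |t|) ^ 2 * coeff r D (max |ξ| 1) :=
      (hr.coeff_le hσ0 hσ).trans (hr.coeff_growth hξ1 hξσ hc)
    have h2 : r (max |t - ξ| 1) ≤ r (|ξ| + |t|) :=
      hr.r_mono hσ0.le (mem_Ici.2 (by linarith)) hσ
    have h3 : r (|ξ| + |t|) ≤ r (|ξ| + k) + L * |t| := by
      have := hr.lipschitz (|ξ| + k) (|ξ| + |t|) (by linarith) (by linarith)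
      nlinarith
    have h4 : r (|ξ| + |t|) ≤ r (|ξ| + k) * |t| := by
      have h := hr.chord (|ξ| + k) (|ξ| + |t|) (by linarith) (by linarith)
      refine le_of_mul_le_mul_right (h.trans ?_) (show 0 < |ξ| + k by linarith)
      rw [mul_assoc]
      refine mul_le_mul_of_nonneg_left ?_ hrk.le
      nlinarith
    have h5 : r (max |t - ξ| 1) ^ 2 - (a + r (|ξ| + k)) ^ 2 ≤
        2 * L * (1 + |t|) ^ 2 * r (|ξ| + k) := by
      have e1 : r (max |t - ξ| 1) ^ 2 ≤ r (|ξ| + |t|) ^ 2 := by gcongr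
      have e2 : r (|ξ| + k) ^ 2 ≤ (a + r (|ξ| + k)) ^ 2 := by gcongr; linarith
      have e3 : r (|ξ| + k) ≤ r (|ξ| + |t|) :=
        hr.r_mono (mem_Ici.2 (by linarith)) (mem_Ici.2 (by linarith)) (by linarith)
      have e4 : r (|ξ| + |t|) ^ 2 - r (|ξ| + k) ^ 2 ≤ (L * |t|) * (2 * (r (|ξ| + k) * |t|)) := by
        rw [sq_sub_sq, mul_comm]
        refine mul_le_mul (by linarith) ?_ (by linarith) (by positivity)
        nlinarith
      have e5 : (L * |t|) * (2 * (r (|ξ| + k) * |t|)) ≤ 2 * L * (1 + |t|) ^ 2 * r (|ξ| + k) := by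
        rw [show (L * |t|) * (2 * (r (|ξ| + k) * |t|)) = 2 * L * |t| ^ 2 * r (|ξ| + k) by ring]
        gcongr
        linarith
      linarith
    calc _ ≤ coeff r D (max |t - ξ| 1) * (2 * L * (1 + |t|) ^ 2 * r (|ξ| + k)) :=
          mul_le_mul_of_nonneg_left h5 hh
      _ ≤ 2 * (1 + |t|) ^ 2 * coeff r D (max |ξ| 1) * (2 * L * (1 + |t|) ^ 2 * r (|ξ| + k)) :=
          mul_le_mul_of_nonneg_right h1 (by positivity)
      _ = _ := by ring
  · rw [indicator_of_notMem (show t ∉ {t : ℝ | k < |t|} from ht)]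
    have hσ : max |t - ξ| 1 ≤ |ξ| + k := max_le (habs.trans (by linarith)) (by linarith)
    have h2 : r (max |t - ξ| 1) ≤ r (|ξ| + k) := hr.r_mono hσ0.le (mem_Ici.2 (by linarith)) hσ
    refine mul_nonpos_of_nonneg_of_nonpos hh (sub_nonpos.2 ?_)
    gcongr
    linarith

/-- On a unit interval next to `0`, the kernel is bounded below. -/
theorem le_coeff_mul (hr : IsProfile r D L) {a k : ℝ} (ha : 0 < a) (hk : 1 ≤ k) {ξ t : ℝ}
    (ht : |t| ≤ 1) (hξt : |ξ| ≤ |t - ξ|) :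
    coeff r D (max |ξ| 1) * r (|ξ| + k) * (2 * a) ≤
      coeff r D (max |t - ξ| 1) * ((a + r (|ξ| + k)) ^ 2 - r (max |t - ξ| 1) ^ 2) := by
  have hξ := abs_nonneg ξ
  have hσ0 : (0 : ℝ) < max |t - ξ| 1 := zero_lt_one.trans_le (le_max_right _ _)
  have hrk := hr.r_pos (|ξ| + k) (by linarith)
  have habs : |t - ξ| ≤ |t| + |ξ| := abs_sub t ξ
  have hσ : max |t - ξ| 1 ≤ |ξ| + k := max_le (by linarith) (by linarith)
  have h2 : r (max |t - ξ| 1) ≤ r (|ξ| + k) := hr.r_mono hσ0.le (mem_Ici.2 (by linarith)) hσ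
  have h3 : r (max |t - ξ| 1) ^ 2 ≤ r (|ξ| + k) ^ 2 := by
    have := (hr.r_pos _ hσ0).le
    gcongr
  rw [mul_assoc]
  refine mul_le_mul (hr.coeff_le (zero_lt_one.trans_le (le_max_right _ _))
    (max_le_max_right 1 hξt)) ?_ (by positivity) (hr.coeff_pos hσ0).le
  nlinarith

/-- For a large enough shift `k`, the kernel inequality of the uniqueness criterion holds. -/
theorem exists_shift (hr : IsProfile r D L) (hL : 0 ≤ L) {a : ℝ} (ha : 0 < a) {w : ℝ → ℝ}
    (hw0 : ∀ t, 0 ≤ w t) (hw : ∀ t, w (-t) = w t)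
    (hint : ∀ n : ℕ, Integrable (fun t => |t| ^ n * w t)) (hpos : 0 < ∫ t in (0 : ℝ)..1, w t) :
    ∃ k : ℝ, 1 ≤ k ∧
      (∀ ξ, ∫⁻ s, ENNReal.ofReal (coeff r D (max |s| 1) *
          (r (max |s| 1) ^ 2 - (a + r (|ξ| + k)) ^ 2)) * ENNReal.ofReal (w (ξ + s)) ≤
        ∫⁻ s, ENNReal.ofReal (coeff r D (max |s| 1) *
          ((a + r (|ξ| + k)) ^ 2 - r (max |s| 1) ^ 2)) * ENNReal.ofReal (w (ξ + s))) ∧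
      ∃ C : ℝ, 0 ≤ C ∧ ∀ ξ, ∫⁻ s, ENNReal.ofReal (coeff r D (max |s| 1) *
          (r (max |s| 1) ^ 2 - (a + r (|ξ| + k)) ^ 2)) * ENNReal.ofReal (w (ξ + s)) ≤
        ENNReal.ofReal (C * (1 + ξ ^ 2)) := by
  set F : ℝ → ℝ := fun t => 4 * L * (1 + |t|) ^ 4 * w t with hF
  have hFi : Integrable F := by
    have e : F = fun t => (4 * L) * (|t| ^ 0 * w t + 4 * (|t| ^ 1 * w t) + 6 * (|t| ^ 2 * w t) +
        4 * (|t| ^ 3 * w t) + |t| ^ 4 * w t) := by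
      ext t; simp only [F]; ring
    rw [e]
    exact (((((hint 0).add ((hint 1).const_mul 4)).add ((hint 2).const_mul 6)).add
      ((hint 3).const_mul 4)).add (hint 4)).const_mul _
  have hF0 : ∀ t, 0 ≤ F t := fun t => by
    have := hw0 t
    simp only [F]; positivity
  set c := ∫ t in (0 : ℝ)..1, w t with hc
  have i0 : Integrable w := by simpa using hint 0
  obtain ⟨k, hk, hkε⟩ := exists_setIntegral_abs_gt_le hFi (ε := 2 * a * c) (by positivity)
  have hset : MeasurableSet {t : ℝ | k < |t|} :=
    measurableSet_lt measurable_const continuous_abs.measurable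
  set tail := ∫ t in {t : ℝ | k < |t|}, F t with htail
  have htail0 : 0 ≤ tail := setIntegral_nonneg hset fun t _ => hF0 t
  set Q : ℝ → ℝ := fun ξ => coeff r D (max |ξ| 1) * r (|ξ| + k) with hQ
  have hQ0 : ∀ ξ, 0 ≤ Q ξ := fun ξ => mul_nonneg
    (hr.coeff_pos (zero_lt_one.trans_le (le_max_right _ _))).le
    (hr.r_pos _ (by linarith [abs_nonneg ξ])).le
  -- both sides in the variable `t = ξ + s`
  have hshift : ∀ (K : ℝ → ENNReal) (ξ : ℝ), ∫⁻ s, K s * ENNReal.ofReal (w (ξ + s)) =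
      ∫⁻ t, K (t - ξ) * ENNReal.ofReal (w t) := fun K ξ => by
    rw [← lintegral_add_left_eq_self (fun t => K (t - ξ) * ENNReal.ofReal (w t)) ξ]
    simp only [add_sub_cancel_left]
  have hneg : ∀ ξ, ∫⁻ s, ENNReal.ofReal (coeff r D (max |s| 1) *
      (r (max |s| 1) ^ 2 - (a + r (|ξ| + k)) ^ 2)) * ENNReal.ofReal (w (ξ + s)) ≤
        ENNReal.ofReal (Q ξ * tail) := by
    intro ξ
    rw [hshift (fun s => ENNReal.ofReal (coeff r D (max |s| 1) *
      (r (max |s| 1) ^ 2 - (a + r (|ξ| + k)) ^ 2)))]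
    have e : ENNReal.ofReal (Q ξ * tail) =
        ∫⁻ t, ENNReal.ofReal ({t : ℝ | k < |t|}.indicator (fun t => Q ξ * F t) t) := by
      rw [htail, ← integral_const_mul, ← integral_indicator hset]
      exact ofReal_integral_eq_lintegral_ofReal ((hFi.const_mul _).indicator hset)
        (Eventually.of_forall fun t => indicator_nonneg
          (fun t _ => mul_nonneg (hQ0 ξ) (hF0 t)) t)
    rw [e]
    refine lintegral_mono fun t => ?_
    rw [← ENNReal.ofReal_mul' (hw0 t)]
    refine ENNReal.ofReal_le_ofReal ((mul_le_mul_of_nonneg_right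
      (hr.coeff_mul_le hL ha hk ξ t) (hw0 t)).trans (le_of_eq ?_))
    by_cases ht : t ∈ {t : ℝ | k < |t|}
    · rw [indicator_of_mem ht, indicator_of_mem ht]; simp only [hQ, hF]; ring
    · rw [indicator_of_notMem ht, indicator_of_notMem ht, zero_mul]
  have hposK : ∀ ξ, ENNReal.ofReal (Q ξ * (2 * a * c)) ≤ ∫⁻ s, ENNReal.ofReal
      (coeff r D (max |s| 1) * ((a + r (|ξ| + k)) ^ 2 - r (max |s| 1) ^ 2)) *
        ENNReal.ofReal (w (ξ + s)) := by
    intro ξ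
    rw [hshift (fun s => ENNReal.ofReal (coeff r D (max |s| 1) *
      ((a + r (|ξ| + k)) ^ 2 - r (max |s| 1) ^ 2)))]
    -- the half of `[-1, 1]` on which `|t - ξ|` is at least `|ξ|`
    obtain ⟨u, v, huv, hI, hJ⟩ : ∃ u v : ℝ, u ≤ v ∧ ∫ t in u..v, w t = c ∧
        ∀ t ∈ Ioc u v, |t| ≤ 1 ∧ |ξ| ≤ |t - ξ| := by
      rcases le_total ξ 0 with h | h
      · refine ⟨0, 1, zero_le_one, rfl, fun t ht => ⟨abs_le.2 ⟨by linarith [ht.1], ht.2⟩, ?_⟩⟩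
        rw [abs_of_nonpos h]
        exact le_trans (by linarith [ht.1]) (le_abs_self _)
      · refine ⟨-1, 0, by norm_num, ?_, fun t ht => ⟨abs_le.2 ⟨ht.1.le, by linarith [ht.2]⟩, ?_⟩⟩
        · have := intervalIntegral.integral_comp_neg w (a := -1) (b := 0)
          simpa [hw] using this
        · rw [abs_of_nonneg h]
          exact le_trans (by linarith [ht.2]) (neg_le_abs _)
    have e : ENNReal.ofReal (Q ξ * (2 * a * c)) =
        ∫⁻ t in Ioc u v, ENNReal.ofReal (Q ξ * (2 * a) * w t) := by
      rw [← ofReal_integral_eq_lintegral_ofReal (i0.const_mul _).integrableOn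
        (Eventually.of_forall fun t => mul_nonneg (mul_nonneg (hQ0 ξ) (by positivity)) (hw0 t)),
        ← intervalIntegral.integral_of_le huv, intervalIntegral.integral_const_mul, hI]
      congr 1; ring
    rw [e]
    refine (setLIntegral_mono' measurableSet_Ioc fun t ht => ?_).trans
      (setLIntegral_le_lintegral _ _)
    rw [← ENNReal.ofReal_mul' (hw0 t)]
    exact ENNReal.ofReal_le_ofReal (mul_le_mul_of_nonneg_right
      (hr.le_coeff_mul ha hk (hJ t ht).1 (hJ t ht).2) (hw0 t))
  have hD1 := hr.D_pos 1 zero_le_one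
  refine ⟨k, hk, fun ξ => (hneg ξ).trans (le_trans (ENNReal.ofReal_le_ofReal
    (mul_le_mul_of_nonneg_left hkε (hQ0 ξ))) (hposK ξ)),
    2 * D 1 * (1 + k) * tail, by positivity, fun ξ => (hneg ξ).trans
    (ENNReal.ofReal_le_ofReal ?_)⟩
  have hξ := abs_nonneg ξ
  set σ := max |ξ| 1 with hσ
  have hσ1 : 1 ≤ σ := le_max_right _ _
  have hσξ : |ξ| ≤ σ := le_max_left _ _
  have hσ2 : σ ^ 2 ≤ 1 + ξ ^ 2 := by
    rcases max_choice |ξ| 1 with h | h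
    · rw [hσ, h, sq_abs]; linarith
    · rw [hσ, h]; nlinarith [sq_nonneg ξ]
  have hrσ := hr.r_pos σ (by linarith)
  have h1 : r (|ξ| + k) ≤ r σ * (1 + k) := by
    have h := hr.chord σ (σ + k) (by linarith) (by linarith)
    have h' := hr.r_mono (mem_Ici.2 (by linarith)) (mem_Ici.2 (by linarith))
      (show |ξ| + k ≤ σ + k by linarith)
    refine h'.trans (le_of_mul_le_mul_right (h.trans ?_) (show 0 < σ by linarith))
    rw [mul_assoc]
    refine mul_le_mul_of_nonneg_left ?_ hrσ.le
    nlinarith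
  have h2 : D σ ≤ 2 * D 1 * σ := by
    have := hr.growth 1 σ le_rfl hσ1
    linarith
  have h3 : Q ξ ≤ 2 * D 1 * (1 + k) * σ ^ 2 := by
    have hDσ := hr.D_pos σ (by linarith)
    calc Q ξ ≤ coeff r D σ * (r σ * (1 + k)) :=
          mul_le_mul_of_nonneg_left h1 (hr.coeff_pos (by linarith)).le
      _ = D σ * (σ * (1 + k)) := by rw [coeff]; field_simp
      _ ≤ 2 * D 1 * σ * (σ * (1 + k)) := mul_le_mul_of_nonneg_right h2 (by positivity)
      _ = _ := by ring
  calc Q ξ * tail ≤ 2 * D 1 * (1 + k) * σ ^ 2 * tail := mul_le_mul_of_nonneg_right h3 htail0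
    _ ≤ 2 * D 1 * (1 + k) * (1 + ξ ^ 2) * tail := by gcongr
    _ = _ := by ring

end IsProfile

/-! ### Convexity and log-concavity of admissible functions -/

namespace SubexpAdmissible

variable {S : ℝ → ℝ}

theorem differentiableAt (hS : SubexpAdmissible S) {t : ℝ} (ht : 0 < t) : DifferentiableAt ℝ S t :=
  (hS.contDiffOn.contDiffAt (Ioi_mem_nhds ht)).differentiableAt (by norm_num)

/-- The graph lies above its tangents. -/
theorem tangent_le (hS : SubexpAdmissible S) {y z : ℝ} (hy : 0 < y) (hz : 0 ≤ z) :
    S y + deriv S y * (z - y) ≤ S z := by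
  have hd := hS.differentiableAt hy
  rcases lt_trichotomy y z with h | h | h
  · have := hS.convexOn.deriv_le_slope (mem_Ici.2 hy.le) (mem_Ici.2 hz) h hd
    rw [slope_def_field, le_div_iff₀ (by linarith)] at this
    linarith
  · simp [h]
  · have := hS.convexOn.slope_le_deriv (mem_Ici.2 hz) (mem_Ici.2 hy.le) h hd
    rw [slope_def_field, div_le_iff₀ (by linarith)] at this
    linarith

theorem deriv_mono (hS : SubexpAdmissible S) {y z : ℝ} (hy : 0 < y) (hyz : y ≤ z) :
    deriv S y ≤ deriv S z := by
  rcases hyz.eq_or_lt with rfl | h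
  · rfl
  · have h1 := hS.tangent_le hy (hy.trans h).le
    have h2 := hS.tangent_le (hy.trans h) hy.le
    nlinarith

theorem deriv_pos (hS : SubexpAdmissible S) {y : ℝ} (hy : 0 < y) : 0 < deriv S y := by
  have h1 := hS.tangent_le hy le_rfl
  have h2 := hS.strictMonoOn (mem_Ici.2 le_rfl) (mem_Ici.2 hy.le) hy
  nlinarith

/-- The chord property: slopes from a fixed point increase. -/
theorem chord_le (hS : SubexpAdmissible S) {a y z : ℝ} (ha : 0 ≤ a) (hy : a ≤ y) (hz : y ≤ z) :
    (S y - S a) * (z - a) ≤ (S z - S a) * (y - a) := by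
  rcases hy.eq_or_lt with rfl | hy
  · simp
  have h := hS.convexOn.secant_mono (mem_Ici.2 ha) (mem_Ici.2 (ha.trans hy.le))
    (mem_Ici.2 (ha.trans (hy.le.trans hz))) hy.ne' (hy.trans_le hz).ne' hz
  rwa [div_le_div_iff₀ (by linarith) (by linarith)] at h

/-- The consequence of log-concavity: where `φ = (S²)'` is log-concave, the quotient
`φ / (S² - S(T₀)²)` decreases. -/
theorem exists_growth (hS : SubexpAdmissible S) : ∃ T : ℝ, 0 < T ∧ ∀ y z, T ≤ y → y ≤ z →
    deriv S z * S z * (S y ^ 2 - S T ^ 2) ≤ deriv S y * S y * (S z ^ 2 - S T ^ 2) := by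
  obtain ⟨T, hT, hlog⟩ := hS.logConcave
  refine ⟨T, hT, fun y z hy hz => ?_⟩
  set φ : ℝ → ℝ := fun t => deriv (fun s : ℝ => S s ^ 2) t with hφ
  have hSpos : ∀ t, 0 < t → 0 < S t := fun t ht =>
    (hS.nonneg 0 le_rfl).trans_lt (hS.strictMonoOn (mem_Ici.2 le_rfl) (mem_Ici.2 ht.le) ht)
  have hder : ∀ t, 0 < t → HasDerivAt (fun s : ℝ => S s ^ 2) (2 * (deriv S t * S t)) t :=
    fun t ht => by
      refine ((hS.differentiableAt ht).hasDerivAt.pow 2).congr_deriv ?_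
      ring
  have hφe : ∀ t, 0 < t → φ t = 2 * (deriv S t * S t) := fun t ht => (hder t ht).deriv
  have hφpos : ∀ t, 0 < t → 0 < φ t := fun t ht => by
    rw [hφe t ht]
    have := hS.deriv_pos ht
    have := hSpos t ht
    positivity
  -- four points `t ≤ y, t + (z - y) ≤ z` with equal sums
  have hfour : ∀ t, T ≤ t → t ≤ y → φ z * φ t ≤ φ y * φ (t + (z - y)) := by
    intro t ht hty
    have h0 : 0 < t := hT.trans_le ht
    rcases (hty.trans hz).eq_or_lt with h | h
    · have h1 : y = z := le_antisymm hz (h ▸ hty)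
      subst h1
      simp [h]
    have hzt : 0 < z - t := by linarith
    set θ := (y - t) / (z - t) with hθ
    have hθ0 : 0 ≤ θ := div_nonneg (by linarith) hzt.le
    have hθ1 : θ ≤ 1 := (div_le_one hzt).2 (by linarith)
    have e1 : (1 - θ) * t + θ * z = y := by rw [hθ]; field_simp; ring
    have e2 : θ * t + (1 - θ) * z = t + (z - y) := by rw [hθ]; field_simp; ring
    have c1 := hlog.2 (mem_Ici.2 ht) (mem_Ici.2 (ht.trans h.le)) (sub_nonneg.2 hθ1) hθ0 (by ring)
    have c2 := hlog.2 (mem_Ici.2 ht) (mem_Ici.2 (ht.trans h.le)) hθ0 (sub_nonneg.2 hθ1) (by ring)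
    simp only [smul_eq_mul, e1] at c1
    simp only [smul_eq_mul, e2] at c2
    have hpz := hφpos z (h0.trans h)
    have hpt := hφpos t h0
    have hpy := hφpos y (h0.trans_le hty)
    have hpw := hφpos (t + (z - y)) (by linarith)
    rw [← Real.log_le_log_iff (by positivity) (by positivity), Real.log_mul hpz.ne' hpt.ne',
      Real.log_mul hpy.ne' hpw.ne']
    simp only [hφ] at c1 c2 ⊢
    linarith
  have hmono : MonotoneOn (fun t => φ y * S (t + (z - y)) ^ 2 - φ z * S t ^ 2) (Icc T y) := by
    have hd : ∀ t ∈ Icc T y, HasDerivAt (fun t => φ y * S (t + (z - y)) ^ 2 - φ z * S t ^ 2)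
        (φ y * φ (t + (z - y)) - φ z * φ t) t := by
      intro t ht
      have h0 : 0 < t := hT.trans_le ht.1
      have h1 : 0 < t + (z - y) := by linarith
      rw [hφe t h0, hφe _ h1]
      exact (((hder _ h1).comp_add_const t (z - y)).const_mul _).sub ((hder t h0).const_mul _)
    refine monotoneOn_of_deriv_nonneg (convex_Icc T y)
      (fun t ht => (hd t ht).continuousAt.continuousWithinAt)
      (fun t ht => (hd t (interior_subset ht)).differentiableAt.differentiableWithinAt)
      fun t ht => ?_
    have ht' := interior_subset ht
    rw [(hd t ht').deriv]
    exact sub_nonneg.2 (hfour t ht'.1 ht'.2)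
  have h := hmono (left_mem_Icc.2 hy) (right_mem_Icc.2 hy) hy
  simp only [add_sub_cancel] at h
  have hyp := hφpos y (hT.trans_le hy)
  have hST : S T ^ 2 ≤ S (T + (z - y)) ^ 2 := by
    have h1 := hS.strictMonoOn.monotoneOn (mem_Ici.2 hT.le)
      (mem_Ici.2 (by linarith : 0 ≤ T + (z - y))) (by linarith)
    have := (hSpos T hT).le
    gcongr
  have h2 := mul_le_mul_of_nonneg_left hST hyp.le
  rw [hφe y (hT.trans_le hy)] at h h2
  rw [hφe z (by linarith)] at h
  linarith

/-- A base point `a` beyond which `S` is large and the slope of `S` grows at most linearly compared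
with its values. -/
theorem exists_base (hS : SubexpAdmissible S) : ∃ a : ℝ, 1 ≤ a ∧ 1 ≤ S a ∧
    ∀ y z, a ≤ y → y ≤ z → deriv S z * S y ≤ 2 * deriv S y * S z := by
  obtain ⟨T, hT, hg⟩ := hS.exists_growth
  have hD := hS.deriv_pos hT
  have hST := hS.nonneg T hT.le
  set a := T + 1 + (S T + 1) / deriv S T with ha
  have haT : T + 1 ≤ a := by
    have : 0 ≤ (S T + 1) / deriv S T := by positivity
    linarith
  have hSa : 2 * S T + 1 ≤ S a := by
    have h := hS.tangent_le hT (by linarith : 0 ≤ a)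
    have e : deriv S T * (a - T) = deriv S T + (S T + 1) := by rw [ha]; field_simp; ring
    linarith
  refine ⟨a, by linarith, by linarith, fun y z hy hz => ?_⟩
  have hSy : S a ≤ S y := hS.strictMonoOn.monotoneOn (mem_Ici.2 (by linarith))
    (mem_Ici.2 (by linarith)) hy
  have hSz : S y ≤ S z := hS.strictMonoOn.monotoneOn (mem_Ici.2 (by linarith))
    (mem_Ici.2 (by linarith)) hz
  have h := hg y z (by linarith) hz
  have hDy := hS.deriv_pos (by linarith : 0 < y)
  have hDz := hS.deriv_pos (by linarith : 0 < z)
  have hy0 : 0 < S y := by linarith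
  have hz0 : 0 < S z := by linarith
  have h1 : S y ^ 2 ≤ 2 * (S y ^ 2 - S T ^ 2) := by nlinarith
  have h2 : (deriv S z * S y) * (S y * S z) ≤ (2 * deriv S y * S z) * (S y * S z) := by
    calc (deriv S z * S y) * (S y * S z) = deriv S z * S z * S y ^ 2 := by ring
      _ ≤ deriv S z * S z * (2 * (S y ^ 2 - S T ^ 2)) := by gcongr
      _ = 2 * (deriv S z * S z * (S y ^ 2 - S T ^ 2)) := by ring
      _ ≤ 2 * (deriv S y * S y * (S z ^ 2 - S T ^ 2)) := by gcongr
      _ ≤ 2 * (deriv S y * S y * S z ^ 2) := by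
          gcongr
          nlinarith [sq_nonneg (S T)]
      _ = _ := by ring
  exact le_of_mul_le_mul_right h2 (by positivity)

/-- Every value above `S a` is taken to the right of `a`. -/
theorem exists_eq (hS : SubexpAdmissible S) {a v : ℝ} (ha : 0 < a) (hv : S a ≤ v) :
    ∃ y, a ≤ y ∧ S y = v := by
  have hD := hS.deriv_pos ha
  set z := a + (v - S a) / deriv S a with hz
  have haz : a ≤ z := by
    have : 0 ≤ (v - S a) / deriv S a := div_nonneg (by linarith) hD.le
    linarith
  have hSz : v ≤ S z := by
    have h := hS.tangent_le ha (ha.le.trans haz)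
    have e : deriv S a * (z - a) = v - S a := by rw [hz]; field_simp; ring
    linarith
  have hc : ContinuousOn S (Icc a z) := fun t ht =>
    (hS.differentiableAt (ha.trans_le ht.1)).continuousAt.continuousWithinAt
  obtain ⟨y, hy, hyv⟩ := intermediate_value_Icc haz hc ⟨hv, hSz⟩
  exact ⟨y, hy.1, hyv⟩

/-- The square of the shifted function `P(x) = S(x + a) - S(a)` lies above the parabola in `x` that
is tangent to it at `x = y - a`: this is the convexity of `u ↦ P(√u)²`. -/
theorem parabola_le (hS : SubexpAdmissible S) {a y x : ℝ} (ha : 0 < a) (hy : a < y) (hx : 0 ≤ x) :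
    (S y - S a) ^ 2 + (S y - S a) * deriv S y / (y - a) * (x ^ 2 - (y - a) ^ 2) ≤
      (S (x + a) - S a) ^ 2 := by
  have hr : 0 < y - a := sub_pos.2 hy
  have hσ : 0 < S y - S a :=
    sub_pos.2 (hS.strictMonoOn (mem_Ici.2 ha.le) (mem_Ici.2 (ha.le.trans hy.le)) hy)
  have hP : 0 ≤ S (x + a) - S a := sub_nonneg.2 (hS.strictMonoOn.monotoneOn (mem_Ici.2 ha.le)
    (mem_Ici.2 (by linarith)) (by linarith))
  have htan := hS.tangent_le (ha.trans hy) (by linarith : 0 ≤ x + a)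
  have hD := hS.deriv_pos (ha.trans hy)
  set r := y - a with hrdef
  set σ := S y - S a with hσdef
  set P := S (x + a) - S a with hPdef
  have htan' : σ + deriv S y * (x - r) ≤ P := by
    rw [show x - r = x + a - y by rw [hrdef]; ring]; linarith
  have e : σ * deriv S y / r * (x ^ 2 - r ^ 2) = (deriv S y * (x - r)) * (σ + σ / r * x) := by
    field_simp; ring
  rw [e]
  have hs : 0 ≤ σ + σ / r * x := by positivity
  rcases le_total r x with h | h
  · have hch : σ / r * x ≤ P := by
      have := hS.chord_le ha.le hy.le (by linarith : y ≤ x + a)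
      rw [div_mul_eq_mul_div, div_le_iff₀ hr]
      simpa using this
    have h1 : (deriv S y * (x - r)) * (σ + σ / r * x) ≤ (P - σ) * (P + σ) :=
      mul_le_mul (by linarith) (by linarith) hs
        (le_trans (mul_nonneg hD.le (by linarith)) (by linarith : deriv S y * (x - r) ≤ P - σ))
    nlinarith
  · have hch : P ≤ σ / r * x := by
      have := hS.chord_le ha.le (by linarith : a ≤ x + a) (by linarith : x + a ≤ y)
      rw [div_mul_eq_mul_div, le_div_iff₀ hr]
      simpa using this
    have h1 : (σ - P) * (P + σ) ≤ (deriv S y * (r - x)) * (σ + σ / r * x) :=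
      mul_le_mul (by linarith) (by linarith) (by linarith) (mul_nonneg hD.le (by linarith))
    nlinarith

/-- The inverse of the shifted function `P(x) = S(x + a) - S(a)` and the slope of `P` there form a
profile. -/
theorem isProfile (hS : SubexpAdmissible S) {R : ℝ → ℝ} (hR : ∀ t, 0 ≤ t → R (S t) = t) {a : ℝ}
    (ha : 0 < a) (hSa : 0 < S a)
    (hg : ∀ y z, a ≤ y → y ≤ z → deriv S z * S y ≤ 2 * deriv S y * S z) :
    IsProfile (fun σ => R (σ + S a) - a) (fun σ => deriv S (R (σ + S a))) (1 / deriv S a) := by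
  have key : ∀ σ, 0 ≤ σ → a ≤ R (σ + S a) ∧ S (R (σ + S a)) = σ + S a := fun σ hσ => by
    obtain ⟨y, hy, hyv⟩ := hS.exists_eq ha (by linarith : S a ≤ σ + S a)
    rw [← hyv, hR y (by linarith)]
    exact ⟨hy, rfl⟩
  have hmono : ∀ σ τ, 0 ≤ σ → σ ≤ τ → R (σ + S a) ≤ R (τ + S a) := fun σ τ hσ hτ => by
    obtain ⟨h1, h2⟩ := key σ hσ
    obtain ⟨h3, h4⟩ := key τ (hσ.trans hτ)
    refine (hS.strictMonoOn.le_iff_le (mem_Ici.2 (by linarith)) (mem_Ici.2 (by linarith))).1 ?_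
    linarith
  have hD := hS.deriv_pos ha
  refine ⟨fun σ hσ τ _ h => sub_le_sub_right (hmono σ τ hσ h) a, fun σ hσ => ?_,
    fun σ hσ τ _ h => hS.deriv_mono (by linarith [key σ hσ]) (hmono σ τ hσ h),
    fun σ hσ => hS.deriv_pos (by linarith [key σ hσ]), fun σ τ hσ h => ?_, fun σ τ hσ h => ?_,
    fun σ τ hσ h => ?_⟩
  · obtain ⟨h1, h2⟩ := key σ hσ.le
    rcases h1.eq_or_lt with h | h
    · rw [← h] at h2; linarith
    · exact sub_pos.2 h
  · obtain ⟨h1, h2⟩ := key σ hσ.le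
    have h3 := (key τ (hσ.le.trans h)).2
    have := hS.chord_le ha.le h1 (hmono σ τ hσ.le h)
    rw [h2, h3] at this
    linarith
  · obtain ⟨h1, h2⟩ := key σ hσ
    have h3 := (key τ (hσ.trans h)).2
    have hm := hmono σ τ hσ h
    have ht := hS.tangent_le (by linarith : 0 < R (σ + S a)) (by linarith : 0 ≤ R (τ + S a))
    have hd := hS.deriv_mono ha h1
    rw [h2, h3] at ht
    rw [one_div, ← div_eq_inv_mul, le_div_iff₀ hD]
    nlinarith
  · have h0 : 0 ≤ σ := by linarith
    obtain ⟨h1, h2⟩ := key σ h0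
    have h3 := (key τ (h0.trans h)).2
    have hG := hg _ _ h1 (hmono σ τ h0 h)
    rw [h2, h3] at hG
    have hDσ := hS.deriv_pos (by linarith : 0 < R (σ + S a))
    have hDτ := hS.deriv_pos (ha.trans_le (key τ (h0.trans h)).1)
    -- `(τ + b) / (σ + b) ≤ τ / σ`
    refine le_of_mul_le_mul_right ?_ (by linarith : 0 < σ + S a)
    calc deriv S (R (τ + S a)) * σ * (σ + S a)
        = deriv S (R (τ + S a)) * (σ + S a) * σ := by ring
      _ ≤ 2 * deriv S (R (σ + S a)) * (τ + S a) * σ := mul_le_mul_of_nonneg_right hG h0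
      _ = 2 * deriv S (R (σ + S a)) * ((τ + S a) * σ) := by ring
      _ ≤ 2 * deriv S (R (σ + S a)) * (τ * (σ + S a)) :=
          mul_le_mul_of_nonneg_left (by nlinarith) (by linarith)
      _ = _ := by ring

/-! ### The uniqueness theorem -/

/-- The uniqueness theorem for an admissible `S`, with its inverse given as a function `R`. -/
theorem exists_isFourierUniquenessPair (hS : SubexpAdmissible S) {R : ℝ → ℝ}
    (hR : ∀ t, 0 ≤ t → R (S t) = t) :
    ∃ d d' : ℝ, 0 ≤ d' ∧ (∀ v, d ≤ v → ∃ t, 0 ≤ t ∧ S t = v) ∧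
      ∀ lam mu : ℤ → ℝ, IsOrderedSequence lam → IsOrderedSequence mu →
        (∀ j : ℤ, S (|lam j| + d') * (lam (j + 1) - lam j) ≤ 1 / 2) →
        (∀ j : ℤ, R (|mu j| + d) * (mu (j + 1) - mu j) ≤ 1 / 2) →
        IsFourierUniquenessPair (range lam) (range mu) FourierSobolev := by
  obtain ⟨a, ha1, hSa1, hg⟩ := hS.exists_base
  have ha : 0 < a := by linarith
  obtain ⟨p, hpc, hps, hp2, heven, hint, hpos⟩ := exists_window
  have hpcs := hasCompactSupport_of_abs_gt hps
  have hp : Integrable p := hpc.integrable_of_hasCompactSupport hpcs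
  have hprof := hS.isProfile hR ha (by linarith) hg
  set r : ℝ → ℝ := fun σ => R (σ + S a) - a with hr
  set D : ℝ → ℝ := fun σ => deriv S (R (σ + S a)) with hD
  set w : ℝ → ℝ := fun t => ‖𝓕 p t‖ ^ 2 with hw
  have hw0 : ∀ t, 0 ≤ w t := fun t => sq_nonneg _
  have hweven : ∀ t, w (-t) = w t := fun t => by simp only [hw, heven]
  have henorm : ∀ t, ‖𝓕 p t‖ₑ ^ 2 = ENNReal.ofReal (w t) := fun t => by
    rw [ENNReal.ofReal_pow (norm_nonneg _), ofReal_norm]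
  have hwi : Integrable w := by simpa using hint 0
  have hw1 : ∫ t, w t = 1 := by
    have h := lintegral_enorm_sq_fourier hp (hpc.memLp_of_hasCompactSupport hpcs)
    rw [hp2] at h
    simp only [henorm] at h
    rw [integral_eq_lintegral_of_nonneg_ae (Eventually.of_forall hw0) hwi.aestronglyMeasurable, h,
      ENNReal.toReal_one]
  have hm : 0 < ∫ t, t ^ 2 * w t := by
    have hi2 : Integrable (fun t => t ^ 2 * w t) := by simpa using hint 2
    have h0 : ∀ t, 0 ≤ t ^ 2 * w t := fun t => mul_nonneg (sq_nonneg t) (hw0 t)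
    refine (integral_nonneg h0).lt_of_ne' fun h => ?_
    have hae := (integral_eq_zero_iff_of_nonneg h0 hi2).1 h
    have : w =ᵐ[volume] 0 := by
      filter_upwards [hae, compl_mem_ae_iff.2 (measure_singleton (0 : ℝ))] with t ht ht0
      have : t ^ 2 ≠ 0 := pow_ne_zero 2 ht0
      simpa [this] using ht
    rw [integral_congr_ae this] at hw1
    simp at hw1
  obtain ⟨k, hk, hker, C, hC, hfin⟩ := hprof.exists_shift (by have := hS.deriv_pos ha; positivity)
    ha hw0 hweven hint hpos
  have hmonoS : ∀ x y, 0 ≤ x → x ≤ y → S x ≤ S y := fun x y hx hxy =>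
    hS.strictMonoOn.monotoneOn (mem_Ici.2 hx) (mem_Ici.2 (hx.trans hxy)) hxy
  -- In both shifts, `1` pays for the variation of `|x|` over a gap; in the second, another `1` pays
  -- for the width of the window, and `a` places `P(|x|)` below `S(|x| + a)`.
  refine ⟨S a + k + 1, a + 2, by linarith, fun v hv => ?_, fun lam mu hlam hmu hlamS hmuR => ?_⟩
  · obtain ⟨y, hy, hyv⟩ := hS.exists_eq ha (by linarith : S a ≤ v)
    exact ⟨y, by linarith, hyv⟩
  intro f hf hfl hfm
  have hmeasS : ∀ c : ℝ, 0 ≤ c → Measurable (fun x : ℝ => S (|x| + c)) := fun c hc => by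
    have : Monotone (fun v : ℝ => S (max v 0 + c)) := fun x y hxy =>
      hmonoS _ _ (add_nonneg (le_max_right _ _) hc) (by gcongr)
    simpa [Function.comp_def] using this.measurable.comp continuous_abs.measurable
  have hmeasr := IsProfile.measurable_comp_max hprof.r_mono
  have hmeasD := IsProfile.measurable_comp_max hprof.D_mono
  have hrk : ∀ ξ : ℝ, 0 < r (|ξ| + k) := fun ξ => hprof.r_pos _ (by linarith [abs_nonneg ξ])
  have hmeasB : Measurable (fun ξ : ℝ => a + r (|ξ| + k)) := by
    have h : ∀ ξ : ℝ, max |(|ξ| + k)| 1 = |ξ| + k := fun ξ => by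
      have := abs_nonneg ξ
      rw [abs_of_nonneg (by linarith), max_eq_left (by linarith)]
    have h2 := hmeasr.comp (show Measurable (fun ξ : ℝ => |ξ| + k) by fun_prop)
    simp only [Function.comp_def, h] at h2
    exact h2.const_add a
  -- for points of a gap of length at most `1`, moving the argument costs at most `1`
  have hgap : ∀ {u v x : ℝ}, x ∈ Ioc u v → v - u ≤ 1 → |x| ≤ |u| + 1 := fun {u v x} hx h => by
    have h1 : |x - u| ≤ 1 := abs_le.2 ⟨by linarith [hx.1], by linarith [hx.2]⟩
    have h2 := abs_sub_abs_le_abs_sub x u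
    linarith
  refine eq_zero_of_kernel_le hf hpc hps hp2 hlam hmu (fun j => hfl _ ⟨j, rfl⟩)
    (fun j => hfm _ ⟨j, rfl⟩) (A := fun x => (S (|x| + a) - S a) ^ 2)
    (B₁ := fun x => S (|x| + (a + 1))) (B := fun ξ => a + r (|ξ| + k))
    (h := fun s => IsProfile.coeff r D (max |s| 1)) (ρ := fun s => r (max |s| 1))
    (((hmeasS a ha.le).sub_const _).pow_const 2) (hmeasS _ (by linarith)) hmeasB ?_ hmeasr
    (fun s => (hprof.coeff_pos (zero_lt_one.trans_le (le_max_right _ _))).le)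
    (fun x => hS.nonneg _ (by positivity)) (fun ξ => (add_pos ha (hrk ξ)).le) ?_ ?_ ?_ ?_ hm
    (fun ξ => ?_) (fun ξ => ?_) hC (fun ξ => ?_)
  · exact ((continuous_abs.measurable.max measurable_const).mul hmeasD).div hmeasr
  · intro j x hx
    have hpos : 0 < lam (j + 1) - lam j := sub_pos.2 (hlam.strictMono (lt_add_one j))
    have h1 := hlamS j
    have h0 := abs_nonneg (lam j)
    have h2 : S a ≤ S (|lam j| + (a + 2)) := hmonoS _ _ ha.le (by linarith)
    have hg1 : lam (j + 1) - lam j ≤ 1 := by nlinarith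
    have h3 := hgap hx hg1
    refine le_trans (mul_le_mul_of_nonneg_right (hmonoS _ _ (by positivity) ?_) hpos.le) h1
    linarith
  · intro j x hx
    have hpos : 0 < mu (j + 1) - mu j := sub_pos.2 (hmu.strictMono (lt_add_one j))
    have h1 := hmuR j
    have h0 := abs_nonneg (mu j)
    have e : R (|mu j| + (S a + k + 1)) = a + r (|mu j| + k + 1) := by
      simp only [hr]; rw [add_sub_cancel]; congr 1; ring
    rw [e] at h1
    have h2 := hprof.r_pos (|mu j| + k + 1) (by linarith)
    have hg1 : mu (j + 1) - mu j ≤ 1 := by nlinarith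
    have h3 := hgap hx hg1
    refine le_trans (mul_le_mul_of_nonneg_right ?_ hpos.le) h1
    have := hprof.r_mono (mem_Ici.2 (by positivity)) (mem_Ici.2 (by linarith))
      (show |x| + k ≤ |mu j| + k + 1 by linarith)
    linarith
  · intro s x
    have hσ : (0 : ℝ) < max |s| 1 := zero_lt_one.trans_le (le_max_right _ _)
    obtain ⟨y, hy, hyv⟩ := hS.exists_eq ha (by linarith : S a ≤ max |s| 1 + S a)
    have hry : r (max |s| 1) = y - a := by simp only [hr]; rw [← hyv, hR y (by linarith)]
    have hDy : D (max |s| 1) = deriv S y := by simp only [hD]; rw [← hyv, hR y (by linarith)]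
    have hya : a < y := by
      have := hprof.r_pos _ hσ
      linarith
    have h := hS.parabola_le ha hya (abs_nonneg x)
    rw [show S y - S a = max |s| 1 by linarith, sq_abs] at h
    simp only [IsProfile.coeff, hry, hDy]
    have hs : s ^ 2 ≤ max |s| 1 ^ 2 := by
      rw [← sq_abs s]
      exact pow_le_pow_left₀ (abs_nonneg s) (le_max_left _ _) 2
    linarith
  · intro x y hy
    have h1 : |x| ≤ |x - y| + 1 := by
      have := abs_sub_abs_le_abs_sub x (x - y)
      rw [sub_sub_cancel] at this
      linarith
    have h2 : S (|x| + a) ≤ S (|x - y| + (a + 1)) := hmonoS _ _ (by positivity) (by linarith)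
    have h3 : S a ≤ S (|x| + a) := hmonoS _ _ ha.le (by linarith [abs_nonneg x])
    have : 0 ≤ S (|x| + a) - S a := by linarith
    gcongr
    linarith
  · simp only [henorm]
    exact lintegral_sq_mul_comp_add hw0 hweven hint hw1 ξ
  · simp only [henorm]
    exact hker ξ
  · simp only [henorm]
    exact hfin ξ

end SubexpAdmissible

/-- `S` is a bijection between its domain `S.source` and its range `S.target`, and `S.symm` is the
inverse function; the one that is admissible has domain `[0,∞)`. The shifts keep all arguments
inside the domains of `S` and of `S.symm`. -/
theorem mainTheorem1 (S : PartialEquiv ℝ ℝ)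
    (hS : (S.source = Set.Ici 0 ∧ SubexpAdmissible S) ∨
      (S.target = Set.Ici 0 ∧ SubexpAdmissible S.symm)) :
    ∃ d d' : ℝ, Set.Ici d' ⊆ S.source ∧ Set.Ici d ⊆ S.target ∧
      ∀ lam mu : ℤ → ℝ, IsOrderedSequence lam → IsOrderedSequence mu →
        (∀ j : ℤ, S (|lam j| + d') * (lam (j + 1) - lam j) ≤ 1 / 2) →
        (∀ j : ℤ, S.symm (|mu j| + d) * (mu (j + 1) - mu j) ≤ 1 / 2) →
        IsFourierUniquenessPair (Set.range lam) (Set.range mu) FourierSobolev := by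
  rcases hS with ⟨hs, hS⟩ | ⟨ht, hS⟩
  · obtain ⟨d, d', hd', hd, H⟩ := hS.exists_isFourierUniquenessPair (R := S.symm)
      fun t ht => S.left_inv (by rw [hs]; exact ht)
    refine ⟨d, d', ?_, fun v hv => ?_, H⟩
    · rw [hs]; exact Ici_subset_Ici.2 hd'
    · obtain ⟨t, ht, rfl⟩ := hd v hv
      exact S.map_source (by rw [hs]; exact ht)
  -- Here `S.symm` plays the role of `S`, so `lam` and `mu` are exchanged.
  · obtain ⟨d, d', hd', hd, H⟩ := hS.exists_isFourierUniquenessPair (R := S)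
      fun t h => S.right_inv (by rw [ht]; exact h)
    refine ⟨d', d, fun v hv => ?_, ?_, fun lam mu hlam hmu hlamS hmuS f hf hfl hfm x => ?_⟩
    · obtain ⟨t, h, rfl⟩ := hd v hv
      exact S.map_target (by rw [ht]; exact h)
    · rw [ht]; exact Ici_subset_Ici.2 hd'
    · have hF := FourierSobolev.fourier_conj_fourier hf
      have h0 := H mu lam hmu hlam hmuS hlamS _ (FourierSobolev.conj_fourier_mem hf)
        (fun ξ hξ => by simp [hfm ξ hξ]) (fun y hy => by rw [hF]; simp [hfl y hy])
      have h1 := congrFun hF x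
      rw [funext h0, Real.fourier_real_eq] at h1
      simpa using h1.symm
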